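/- Let $E/\mathbb{Q}$ be an elliptic curve given by a rational Weierstrass equation $y^2+a_1xy+a_3y=x^3+a_2x^2+a_4x+a_6$ (not necessarily integral or minimal), let $\infty$ be its origin, $Y=E\smallsetminus\{\infty\}$, and let $\ell$ be a prime, with $|\cdot|_\ell$ the absolute value on $\overline{\mathbb{Q}}_\ell$ normalised by $|\ell|_\ell=\ell^{-1}$. *Silverman's local height* is the function $\hat\lambda_\ell\colon Y(\mathbb{Q}_\ell)\to\mathbb{R}$ characterised by: (a) $\hat\lambda_\ell$ is continuous on $Y(\mathbb{Q}_\ell)$ and bounded on the complement of each $\ell$-adic neighbourhood of $\infty\in E(\mathbb{Q}_\ell)$; (b) $\lim_{Q\to\infty}\bigl(\hat\lambda_\ell(Q)-\tfrac12\log|x(Q)|_\ell\bigr)$ exists; (c) $\hat\lambda_\ell(2Q)=4\hat\lambda_\ell(Q)-\log|2y(Q)+a_1x(Q)+a_3|_\ell$ for all $Q\in(E\smallsetminus E[2])(\mathbb{Q}_\ell)$. Let $L=\mathcal{O}(\infty)$, with sections viewed as rational functions on $E$; it is generated over $Y$ by the rational function $1$ and over a neighbourhood of $\infty$ by $t^{-1}$,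 where $t=-x/y$. It is rigidified by the value of $t^{-1}$ at $\infty$. A metric on $L$ is a norm $\|\cdot\|\colon L(\overline{\mathbb{Q}}_\ell)\to\mathbb{R}_{\ge0}$ on its fibres; it is locally bounded if the logarithms of the norms of local generators are bounded on bounded sets. The *canonical $\ell$-adic metric* $\|\cdot\|_{L,\ell}$ is the locally bounded metric on $L$ for which the isomorphism of rigidified line bundles $L^{\otimes4}\cong[2]^*L$ is an isometry. Then there is exactly one function $\hat\lambda_\ell$ and exactly one metric $\|\cdot\|_{L,\ell}$ with these properties, and if $f\in\mathrm{H}^0(Y,L)$ is the section corresponding to the rational function $1$, then $$\hat\lambda_\ell(Q)=-\log\|f(Q)\|_{L,\ell}\qquad\text{for all }Q\in Y(\mathbb{Q}_\ell).$$ -/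

import Mathlib

open Topology

namespace EllipticMetric

noncomputable section

/-! ### Points of a Weierstrass curve in the projective plane -/

section Points

variable {F : Type*} [Field F] {W : WeierstrassCurve.Affine F}

/-- Homogeneous coordinates of a point: `∞ = [0 : 1 : 0]` and `(x, y) = [x : y : 1]`. -/
def coords : W.Point → Fin 3 → F
  | .zero => ![0, 1, 0]
  | .some x y _ => ![x, y, 1]

/-- The function `x` on `Y = E ∖ {∞}` (with the value `0` at `∞`, which is never used). -/
def xCoord : W.Point → F
  | .zero => 0
  | .some x _ _ => x

/-- The function `y` on `Y = E ∖ {∞}` (with the value `0` at `∞`, which is never used). -/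
def yCoord : W.Point → F
  | .zero => 0
  | .some _ y _ => y

/-- The function `t = -x / y`; it is used on `Y ∩ U` only, see `Chart.domain`. -/
def tCoord (Q : W.Point) : F := -xCoord Q / yCoord Q

theorem coords_ne_zero (Q : W.Point) : coords Q ≠ 0 := by
  cases Q with
  | zero => exact fun h => one_ne_zero (congrFun h 1)
  | some x y _ => exact fun h => one_ne_zero (congrFun h 2)

/-- The embedding of `E(F)` in the projective plane. -/
def toProjectivePlane (Q : W.Point) : Projectivization F (Fin 3 → F) :=
  Projectivization.mk F (coords Q) (coords_ne_zero Q)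

/-- For a topological field `F`, the topology of `E(F)` as a subspace of the projective plane
`ℙ²(F)`, which carries the quotient topology from `F³ ∖ {0}`. -/
instance pointTopology [TopologicalSpace F] : TopologicalSpace W.Point :=
  TopologicalSpace.induced toProjectivePlane
    (TopologicalSpace.coinduced
      (fun v : {v : Fin 3 → F // v ≠ 0} => Projectivization.mk F v.1 v.2) inferInstance)

/-- The set `Y(F)`, where `Y = E ∖ {∞}`. -/
abbrev AffinePoint (W : WeierstrassCurve.Affine F) : Type _ := {Q : W.Point // Q ≠ 0}

/-- A function on a set `S` of points is regular if near each point of `S` it is a quotient of two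
homogeneous forms of the same degree (the classical definition, for `S` Zariski open and `F`
algebraically closed). -/
def IsRegularOn (g : W.Point → F) (S : Set W.Point) : Prop :=
  ∀ Q₀ ∈ S, ∃ (d : ℕ) (A B : MvPolynomial (Fin 3) F), A.IsHomogeneous d ∧ B.IsHomogeneous d ∧
    MvPolynomial.eval (coords Q₀) B ≠ 0 ∧
    ∀ Q ∈ S, MvPolynomial.eval (coords Q) B ≠ 0 →
      g Q = MvPolynomial.eval (coords Q) A / MvPolynomial.eval (coords Q) B

end Points

/-! ### Silverman's local height -/

section LocalHeight

open Classical in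
/-- Silverman's local height on `Y(F)`, for a Weierstrass curve over a normed field `F`
(here `F = ℚ_ℓ`): the continuous function on `Y(F)` that is bounded outside each neighbourhood
of `∞`, differs near `∞` from `(1/2) log |x|` by a function that has a limit, and satisfies
the duplication formula. -/
structure IsLocalHeight {F : Type*} [NormedField F] {W : WeierstrassCurve.Affine F}
    (lam : AffinePoint W → ℝ) : Prop where
  continuous : Continuous lam
  bounded : ∀ N ∈ 𝓝 (0 : W.Point), ∃ C : ℝ, ∀ Q : AffinePoint W, Q.1 ∉ N → |lam Q| ≤ C
  limit : ∃ c : ℝ, Filter.Tendsto (fun Q : AffinePoint W => lam Q - 1 / 2 * Real.log ‖xCoord Q.1‖)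
    (Filter.comap Subtype.val (𝓝 (0 : W.Point))) (𝓝 c)
  duplication : ∀ (Q : AffinePoint W) (h : (2 : ℕ) • Q.1 ≠ 0),
    lam ⟨(2 : ℕ) • Q.1, h⟩ =
      4 * lam Q - Real.log ‖2 * yCoord Q.1 + W.a₁ * xCoord Q.1 + W.a₃‖

end LocalHeight

/-! ### The line bundle `L = 𝒪(∞)`, by its two trivialisations -/

/-- The two charts of `E`: `Y = E ∖ {∞}`, and a neighbourhood `U` of `∞`. -/
inductive Chart
  | Y
  | U

section LineBundle

variable {K : Type*} [Field K] {W : WeierstrassCurve.Affine K}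

/-- `Y` is the complement of `∞`; `U` is the locus in the curve
`u = t³ + a₁tu + a₂t²u + a₃u² + a₄tu² + a₆u³`, with `t = -x / y` and `u = -1 / y`, where the regular
function `t³ / u = 1 - a₁t - a₂t² - a₃u - a₄tu - a₆u²` does not vanish, that is, the set that
consists of `∞` and of the points `(x, y)` with `x ≠ 0` and `y ≠ 0`. -/
def Chart.domain : Chart → Set W.Point
  | .Y => {Q | Q ≠ 0}
  | .U => {Q | Q = 0 ∨ (xCoord Q ≠ 0 ∧ yCoord Q ≠ 0)}

/-- The set of `K`-points of the total space of `L = 𝒪(∞)`. The pair `(Q, z)` is `z` times the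
chosen basis vector of the fibre `L_Q`, namely the value at `Q` of the generating section `1` of
`L` over `Y` if `Q ≠ ∞`, and the value of the generating section `t⁻¹` of `L` over `U`
if `Q = ∞`. The algebraic structure is that of the two charts, see `Chart.generator`. -/
abbrev TotalSpace (W : WeierstrassCurve.Affine K) : Type _ := W.Point × K

open Classical in
/-- The coordinate (with respect to the chosen basis of the fibres) of the section of `L` that
generates `L` over the chart: the rational function `1` over `Y` and `t⁻¹` over `U`. -/
def Chart.generator : Chart → W.Point → K
  | .Y, _ => 1
  | .U, Q => if Q = 0 then 1 else (tCoord Q)⁻¹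

/-- The value at `Q ∈ Y` of the section `f` of `L` that corresponds to the rational
function `1`. -/
def unitSection (Q : AffinePoint W) : TotalSpace W := (Q.1, 1)

open Classical in
/-- `L` is rigidified by the vector `∞̃ = (∞, 1)`, the value of `t⁻¹` at `∞`. The fibrewise
linear isomorphism `L^{⊗ n²} → [n]^* L` with `(Q, z)^{⊗ n²} ↦ (n Q, b(Q) z^{n²})` is an
isomorphism of rigidified line bundles: it is invertible, it takes `∞̃^{⊗ n²}` to `∞̃`, and it is
a regular function with respect to the generators of `L` over the chart `i` (at `Q`) and over the
chart `j` (at `n Q`), for all charts `i` and `j`. -/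
structure IsRigidifiedIso (n : ℕ) (b : W.Point → K) : Prop where
  ne_zero : ∀ Q, b Q ≠ 0
  rigid : b 0 = 1
  regular : ∀ i j : Chart,
    IsRegularOn (fun Q => b Q * i.generator Q ^ (n ^ 2) / j.generator (n • Q))
      (i.domain ∩ {Q | n • Q ∈ j.domain})

end LineBundle

/-! ### Metrics on `L` -/

section Metric

variable {K : Type*} [NormedField K]

/-- A metric on the line bundle `L = 𝒪(∞)`: a norm on each fibre. -/
@[ext]
structure Metric (W : WeierstrassCurve.Affine K) where
  /-- The norm of a vector of the total space. -/
  norm : TotalSpace W → ℝ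
  pos : ∀ (Q : W.Point) (z : K), z ≠ 0 → 0 < norm (Q, z)
  smul : ∀ (Q : W.Point) (c z : K), norm (Q, c * z) = ‖c‖ * norm (Q, z)

variable {W : WeierstrassCurve.Affine K}

/-- The exhaustion of an affine chart by bounded sets: all points where the generators of its
ring of regular functions have absolute value at most `C`. The generators are `x`, `y` for `Y` and
`t`, `u`, `(t³ / u)⁻¹` for `U`; the last three have the values `0`, `0`, `1` at `∞`. -/
def Chart.boundedPart (C : ℝ) : Chart → Set W.Point
  | .Y => {Q | Q ≠ 0 ∧ ‖xCoord Q‖ ≤ C ∧ ‖yCoord Q‖ ≤ C}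
  | .U => {Q | Q = 0 ∨ (xCoord Q ≠ 0 ∧ yCoord Q ≠ 0 ∧ ‖xCoord Q / yCoord Q‖ ≤ C ∧
      ‖1 / yCoord Q‖ ≤ C ∧ ‖yCoord Q ^ 2 / xCoord Q ^ 3‖ ≤ C)}

/-- A metric is locally bounded if for each of the two trivialisations of `L` the logarithm of the
norm of the generating section is bounded on each bounded subset of the chart. -/
def Metric.IsLocallyBounded (M : Metric W) : Prop :=
  ∀ (i : Chart) (C : ℝ), ∃ B : ℝ, ∀ Q ∈ i.boundedPart C,
    |Real.log (M.norm (Q, i.generator Q))| ≤ B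

open Classical in
/-- The canonical metric of the symmetric rigidified line bundle `L = 𝒪(∞)`: the locally bounded
metric for which the isomorphism of rigidified line bundles `L^{⊗ 4} → [2]^* L` is an isometry. -/
structure Metric.IsCanonical (M : Metric W) : Prop where
  locallyBounded : M.IsLocallyBounded
  isometry : ∀ b : W.Point → K, IsRigidifiedIso 2 b →
    ∀ (Q : W.Point) (z : K), M.norm ((2 : ℕ) • Q, b Q * z ^ 4) = M.norm (Q, z) ^ 4

end Metric

/-! ### The inclusion `Y(ℚ_ℓ) ⊆ Y(ℚ̄_ℓ)` -/

open Classical in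
/-- The inclusion of `E(ℚ_ℓ)` in the points over the algebraic closure of `ℚ_ℓ`. -/
def inclusion (W : WeierstrassCurve ℚ) (ℓ : ℕ) [Fact ℓ.Prime] :
    (W.baseChange ℚ_[ℓ]).toAffine.Point →+ (W.baseChange (PadicAlgCl ℓ)).toAffine.Point :=
  WeierstrassCurve.Affine.Point.map (W' := W) (IsScalarTower.toAlgHom ℚ ℚ_[ℓ] (PadicAlgCl ℓ))

theorem inclusion_ne_zero (W : WeierstrassCurve ℚ) (ℓ : ℕ) [Fact ℓ.Prime]
    (Q : (W.baseChange ℚ_[ℓ]).toAffine.Point) (hQ : Q ≠ 0) : inclusion W ℓ Q ≠ 0 := by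
  cases Q with
  | zero => exact absurd rfl hQ
  | some x y h => exact WeierstrassCurve.Affine.Point.some_ne_zero _

/-- The inclusion of `Y(ℚ_ℓ)` in the points over the algebraic closure of `ℚ_ℓ`. -/
def affineInclusion (W : WeierstrassCurve ℚ) (ℓ : ℕ) [Fact ℓ.Prime]
    (Q : AffinePoint (W.baseChange ℚ_[ℓ]).toAffine) :
    AffinePoint (W.baseChange (PadicAlgCl ℓ)).toAffine :=
  ⟨inclusion W ℓ Q.1, inclusion_ne_zero W ℓ Q.1 Q.2⟩

end

end EllipticMetric

/-!
Both objects come from one function. Duplication acts on the `x`-line through two binary quartic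
forms, `dup`, without a common zero. Tate's limit applied to `log ‖·‖` gives a function `homHeight`
on `K² ∖ {0}` that stays within a bounded distance of `log ‖·‖`, is multiplied by `4` under `dup`,
and satisfies `homHeight (c v) = log ‖c‖ + homHeight v`. Since `dup (x, 1)` is `ψ₂²` times
`(x(2Q), 1)`, the function `Q ↦ ½ homHeight (x(Q), 1)` satisfies the duplication formula of the
local height (`isLocalHeight_halfHeight`), and `|z| exp (-½ homHeight (x(Q), 1))` is the canonical
metric (`isCanonical_canonicalMetric`). The algebraic closure of `ℚ_ℓ` is not locally compact, so
all bounds are derived from explicit polynomial identities and not from compactness. The height is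
compatible with isometric field extensions (`homHeight_map`), which gives the comparison.

Uniqueness on both sides rests on the fact that a bounded function that duplication multiplies by
`4` vanishes. For metrics this applies at every point once the isomorphism `L^{⊗ 4} ≅ [2]^* L` is
known to exist (`isRigidifiedIso_dupIso`): it is `-1 / ψ₂` away from the points of order two. For
local heights the duplication formula is available only at points that duplication does not take
to `∞`, and the `2`-power torsion points are reached by continuity: a neighbourhood of a point of
`Y(ℚ_ℓ)` is infinite, while the points killed by a given power of two are finite in number.

That the metric built from the height is canonical also needs the isomorphism to be unique
(`IsRigidifiedIso.eq_dupIso`). The quotient of two choices is a regular function without zeros on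
`Y`. By the Nullstellensatz it is given by a polynomial, hence by `p(x) + q(x) y`; its norm to
`K[x]` has no zeros, which forces it to be constant; and the constant is read off at `∞`.
-/

namespace EllipticMetric

noncomputable section

/-! ### Duplication on a Weierstrass curve -/

section Duplication

variable {F : Type*} [Field F] (W : WeierstrassCurve.Affine F)

/-- The function `ψ₂ = 2y + a₁x + a₃`, whose zeros are the points of order two. -/
def psi (x y : F) : F := 2 * y + W.a₁ * x + W.a₃

/-- The numerator of the slope of the tangent line at `(x, y)`; the denominator is `psi`. -/
def tangentNum (x y : F) : F := 3 * x ^ 2 + 2 * W.a₂ * x + W.a₄ - W.a₁ * y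

/-- The numerator of `x(2Q) = phi / psi ^ 2`. -/
def phi (x : F) : F := x ^ 4 - W.b₄ * x ^ 2 - 2 * W.b₆ * x - W.b₈

/-- The coefficients of `omega` below its leading monomial. -/
def omegaCoeff : Fin 10 → F :=
  ![W.a₁,
    W.a₁ * W.a₂ - 2 * W.a₃,
    3 * W.a₄ - 3 * W.a₁ * W.a₃ + W.a₁ ^ 2 * W.a₂ - W.a₂ ^ 2,
    6 * W.a₁ * W.a₄ - 2 * W.a₁ * W.a₂ ^ 2,
    18 * W.a₆ - 5 * W.a₂ * W.a₄ - W.a₁ * W.a₂ * W.a₃ + W.a₁ ^ 2 * W.a₄ + W.a₂ ^ 3,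
    3 * W.a₃ * W.a₄ + 3 * W.a₁ * W.a₃ ^ 2 + 27 * W.a₁ * W.a₆ - 6 * W.a₁ * W.a₂ * W.a₄
      - 2 * W.a₁ ^ 2 * W.a₂ * W.a₃ + W.a₁ ^ 3 * W.a₄ - W.a₂ ^ 2 * W.a₃ + W.a₁ * W.a₂ ^ 3,
    9 * W.a₁ ^ 2 * W.a₆ - 9 * W.a₄ ^ 2 - 6 * W.a₁ * W.a₃ * W.a₄ + 6 * W.a₂ ^ 2 * W.a₄
      + 2 * W.a₁ * W.a₂ ^ 2 * W.a₃ - W.a₁ ^ 2 * W.a₂ * W.a₄ - W.a₂ ^ 4,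
    W.a₁ ^ 3 * W.a₆ + 3 * W.a₁ * W.a₂ * W.a₆ - W.a₁ * W.a₂ * W.a₃ ^ 2 - W.a₁ * W.a₄ ^ 2
      + 2 * W.a₃ ^ 3 + 18 * W.a₃ * W.a₆ - 5 * W.a₂ * W.a₃ * W.a₄ + W.a₂ ^ 3 * W.a₃,
    6 * W.a₁ ^ 2 * W.a₂ * W.a₆ + 9 * W.a₂ ^ 2 * W.a₆ + 2 * W.a₂ ^ 2 * W.a₃ ^ 2
      + 3 * W.a₂ * W.a₄ ^ 2 - 6 * W.a₃ ^ 2 * W.a₄ - 27 * W.a₄ * W.a₆ - W.a₁ * W.a₃ ^ 3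
      + W.a₁ ^ 4 * W.a₆ - W.a₁ ^ 3 * W.a₃ * W.a₄ + W.a₁ ^ 2 * W.a₂ * W.a₃ ^ 2
      - 2 * W.a₁ ^ 2 * W.a₄ ^ 2 - W.a₂ ^ 3 * W.a₄,
    W.a₂ * W.a₃ ^ 2 * W.a₄ - 2 * W.a₁ * W.a₃ * W.a₄ ^ 2 - W.a₄ ^ 3 + W.a₁ ^ 3 * W.a₃ * W.a₆
      + 6 * W.a₁ * W.a₂ * W.a₃ * W.a₆ - W.a₁ ^ 2 * W.a₃ ^ 2 * W.a₄ + W.a₁ * W.a₂ * W.a₃ ^ 3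
      - W.a₃ ^ 4 - 9 * W.a₃ ^ 2 * W.a₆ - 27 * W.a₆ ^ 2 + 9 * W.a₂ * W.a₄ * W.a₆
      - W.a₂ ^ 3 * W.a₆]

/-- The numerator of `y(2Q) = omega / psi ^ 3`. It is reduced modulo the Weierstrass equation so
that its total degree `4` equals its degree in `y`: the corresponding form of degree `4` does not
vanish at `∞ = [0 : 1 : 0]`. -/
def omega (x y : F) : F :=
  y ^ 4 + omegaCoeff W 0 * x * y ^ 3 + omegaCoeff W 1 * y ^ 3 + omegaCoeff W 2 * x * y ^ 2
    + omegaCoeff W 3 * x ^ 2 * y + omegaCoeff W 4 * y ^ 2 + omegaCoeff W 5 * x * y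
    + omegaCoeff W 6 * x ^ 2 + omegaCoeff W 7 * y + omegaCoeff W 8 * x + omegaCoeff W 9

variable {W} {x y : F}

theorem psi_sq (h : W.Equation x y) :
    psi W x y ^ 2 = 4 * x ^ 3 + W.b₂ * x ^ 2 + 2 * W.b₄ * x + W.b₆ := by
  rw [WeierstrassCurve.Affine.equation_iff] at h
  simp only [psi, WeierstrassCurve.b₂, WeierstrassCurve.b₄, WeierstrassCurve.b₆]
  linear_combination 4 * h

theorem phi_eq (h : W.Equation x y) :
    phi W x = tangentNum W x y ^ 2 + W.a₁ * tangentNum W x y * psi W x y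
      - (W.a₂ + 2 * x) * psi W x y ^ 2 := by
  rw [WeierstrassCurve.Affine.equation_iff] at h
  simp only [psi, phi, tangentNum, WeierstrassCurve.b₄, WeierstrassCurve.b₆, WeierstrassCurve.b₈]
  linear_combination (8 * x + 4 * W.a₂ + W.a₁ ^ 2) * h

theorem omega_eq (h : W.Equation x y) :
    omega W x y = -tangentNum W x y * (phi W x - x * psi W x y ^ 2) - y * psi W x y ^ 3
      - W.a₁ * phi W x * psi W x y - W.a₃ * psi W x y ^ 3 := by
  rw [WeierstrassCurve.Affine.equation_iff] at h
  simp only [psi, phi, tangentNum, omega, omegaCoeff, WeierstrassCurve.b₄, WeierstrassCurve.b₆,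
    WeierstrassCurve.b₈, Matrix.cons_val]
  linear_combination -(3 * x ^ 3 - 9 * y ^ 2 - 8 * W.a₁ * x * y - (2 * W.a₁ ^ 2 + W.a₂) * x ^ 2
    - (9 * W.a₃ + W.a₁ * W.a₂) * y + (-8 * W.a₄ - 8 * W.a₁ * W.a₃ + W.a₂ ^ 2) * x
    + (-9 * W.a₃ ^ 2 - 27 * W.a₆ + 5 * W.a₂ * W.a₄ + 2 * W.a₁ * W.a₂ * W.a₃ - W.a₁ ^ 2 * W.a₄
      - W.a₂ ^ 3)) * h

theorem psi_eq_zero_iff : psi W x y = 0 ↔ y = W.negY x y := by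
  rw [psi, WeierstrassCurve.Affine.negY]
  constructor <;> intro h <;> linear_combination h

theorem tangentNum_ne_zero (h : W.Nonsingular x y) (hψ : psi W x y = 0) :
    tangentNum W x y ≠ 0 := by
  rw [WeierstrassCurve.Affine.nonsingular_iff'] at h
  rcases h.2 with h | h
  · contrapose! h
    rw [tangentNum] at h
    linear_combination -h
  · exact absurd hψ h

theorem phi_of_psi_eq_zero (h : W.Equation x y) (hψ : psi W x y = 0) :
    phi W x = tangentNum W x y ^ 2 := by
  rw [phi_eq h, hψ]; ring

theorem omega_of_psi_eq_zero (h : W.Equation x y) (hψ : psi W x y = 0) :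
    omega W x y = -tangentNum W x y ^ 3 := by
  rw [omega_eq h, phi_of_psi_eq_zero h hψ, hψ]; ring

open Classical in
theorem two_nsmul_of_psi_eq_zero (h : W.Nonsingular x y) (hψ : psi W x y = 0) :
    (2 : ℕ) • (WeierstrassCurve.Affine.Point.some x y h) = 0 := by
  rw [two_nsmul, WeierstrassCurve.Affine.Point.add_self_of_Y_eq (psi_eq_zero_iff.1 hψ)]

open Classical in
theorem two_nsmul_of_psi_ne_zero (h : W.Nonsingular x y) (hψ : psi W x y ≠ 0) :
    ∃ h', (2 : ℕ) • (WeierstrassCurve.Affine.Point.some x y h) =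
      .some (phi W x / psi W x y ^ 2) (omega W x y / psi W x y ^ 3) h' := by
  have hy : y ≠ W.negY x y := fun e => hψ (psi_eq_zero_iff.2 e)
  have hs : W.slope x x y y = tangentNum W x y / psi W x y := by
    rw [WeierstrassCurve.Affine.slope_of_Y_ne rfl hy]
    congr 1
    rw [psi, WeierstrassCurve.Affine.negY]; ring
  have hX : W.addX x x (W.slope x x y y) = phi W x / psi W x y ^ 2 := by
    rw [hs, phi_eq h.1, WeierstrassCurve.Affine.addX]
    field_simp
    ring
  have hY : W.addY x x y (W.slope x x y y) = omega W x y / psi W x y ^ 3 := by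
    rw [WeierstrassCurve.Affine.addY, WeierstrassCurve.Affine.negAddY,
      WeierstrassCurve.Affine.negY, hX, hs, omega_eq h.1]
    field_simp
    ring
  have key := WeierstrassCurve.Affine.Point.add_self_of_Y_ne (h₁ := h) hy
  rw [two_nsmul, key]
  refine ⟨hX ▸ hY ▸ WeierstrassCurve.Affine.nonsingular_add h h fun hxy => hy hxy.right, ?_⟩
  simp only [hX, hY]

open Classical in
theorem two_nsmul_some_eq_zero_iff (h : W.Nonsingular x y) :
    (2 : ℕ) • (WeierstrassCurve.Affine.Point.some x y h) = 0 ↔ psi W x y = 0 := by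
  refine ⟨fun h0 => ?_, two_nsmul_of_psi_eq_zero h⟩
  by_contra hψ
  obtain ⟨h', e⟩ := two_nsmul_of_psi_ne_zero h hψ
  exact WeierstrassCurve.Affine.Point.some_ne_zero h' (e.symm.trans h0)

end Duplication

/-! ### The homogeneous height attached to duplication -/

/-- A bounded function that a self-map multiplies by `4` is zero. -/
theorem eq_zero_of_bounded_of_quadrupled {α : Type*} {s : Set α} {T : α → α}
    (hT : Set.MapsTo T s s) {D : α → ℝ} {B : ℝ} (hB : ∀ a ∈ s, |D a| ≤ B)
    (hD : ∀ a ∈ s, D (T a) = 4 * D a) {a : α} (ha : a ∈ s) : D a = 0 := by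
  have hpow : ∀ n : ℕ, ∀ a ∈ s, (4 : ℝ) ^ n * |D a| ≤ B := by
    intro n
    induction n with
    | zero => intro a ha; simpa using hB a ha
    | succ n ih =>
      intro a ha
      have := ih (T a) (hT ha)
      rw [hD a ha, abs_mul, abs_of_pos (by norm_num : (0 : ℝ) < 4)] at this
      rw [pow_succ, mul_assoc]
      exact this
  by_contra h
  have hpos : 0 < |D a| := abs_pos.2 h
  obtain ⟨n, hn⟩ := pow_unbounded_of_one_lt (B / |D a|) (by norm_num : (1 : ℝ) < 4)
  rw [div_lt_iff₀ hpos] at hn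
  exact absurd (hpow n a ha) (not_le.2 hn)

section HomogeneousHeight

variable {F : Type*} [NormedField F]

theorem exists_norm_eval_le {ι : Type*} [Fintype ι] {p : MvPolynomial ι F} {d : ℕ}
    (hp : p.IsHomogeneous d) :
    ∃ C : ℝ, 0 ≤ C ∧ ∀ v : ι → F, ‖MvPolynomial.eval v p‖ ≤ C * ‖v‖ ^ d := by
  refine ⟨(AddMonoidAlgebra.coeff p).sum (fun _ c => NormedField.toAbsoluteValue F c),
    Finset.sum_nonneg fun _ _ => (NormedField.toAbsoluteValue F).nonneg _, fun v => ?_⟩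
  refine ((NormedField.toAbsoluteValue F).eval_mvPolynomial_le hp v).trans ?_
  refine mul_le_mul_of_nonneg_left ?_ (Finset.sum_nonneg fun _ _ => (NormedField.toAbsoluteValue F).nonneg _)
  refine pow_le_pow_left₀ (Real.iSup_nonneg fun i => (NormedField.toAbsoluteValue F).nonneg (v i)) ?_ _
  exact Real.iSup_le (fun i => norm_le_pi_norm v i) (norm_nonneg _)

variable (W : WeierstrassCurve.Affine F)

/-- The lift to `F²` of the map that duplication induces on the `x`-line `ℙ¹`. -/
def dup (v : F × F) : F × F :=
  (v.1 ^ 4 - W.b₄ * v.1 ^ 2 * v.2 ^ 2 - 2 * W.b₆ * v.1 * v.2 ^ 3 - W.b₈ * v.2 ^ 4,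
    4 * v.1 ^ 3 * v.2 + W.b₂ * v.1 ^ 2 * v.2 ^ 2 + 2 * W.b₄ * v.1 * v.2 ^ 3 + W.b₆ * v.2 ^ 4)

/-- The point `(x² : 2x : 1)` of the symmetric square of the `x`-line, homogenised; on such points
the map `WeierstrassCurve.addSubMap` describes duplication. -/
def diagonal (v : F × F) : Fin 3 → F := ![v.1 ^ 2, 2 * v.1 * v.2, v.2 ^ 2]

theorem norm_diagonal_le (v : F × F) : ‖diagonal v‖ ≤ 2 * ‖v‖ ^ 2 := by
  have h1 := norm_fst_le v
  have h2 := norm_snd_le v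
  have h0 := norm_nonneg v
  have hsq : ∀ a : F, ‖a‖ ≤ ‖v‖ → ‖a ^ 2‖ ≤ 2 * ‖v‖ ^ 2 := fun a ha => by
    rw [norm_pow]
    nlinarith [pow_le_pow_left₀ (norm_nonneg a) ha 2, sq_nonneg ‖v‖]
  refine (pi_norm_le_iff_of_nonneg (by positivity)).2 fun i => ?_
  fin_cases i
  · exact hsq _ h1
  · have h22 : ‖(2 : F)‖ ≤ 2 := by
      simpa using (norm_add_le (1 : F) 1).trans (by norm_num : ‖(1 : F)‖ + ‖(1 : F)‖ ≤ 2) |>.trans'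
        (by norm_num [one_add_one_eq_two])
    calc ‖2 * v.1 * v.2‖ = ‖(2 : F)‖ * ‖v.1‖ * ‖v.2‖ := by rw [norm_mul, norm_mul]
      _ ≤ 2 * ‖v‖ * ‖v‖ := by gcongr
      _ = 2 * ‖v‖ ^ 2 := by ring
  · exact hsq _ h2

theorem eval_addSubMap_diagonal (v : F × F) :
    (MvPolynomial.eval (diagonal v) (W.addSubMap 0) = (dup W v).1) ∧
    (MvPolynomial.eval (diagonal v) (W.addSubMap 1) = (dup W v).2) ∧
    (MvPolynomial.eval (diagonal v) (W.addSubMap 2) = 0) := by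
  refine ⟨?_, ?_, ?_⟩ <;> simp [WeierstrassCurve.addSubMap, diagonal, dup] <;> ring

theorem continuous_dup : Continuous (dup W) := by
  unfold dup; fun_prop

theorem dup_smul (c : F) (v : F × F) : dup W (c • v) = c ^ 4 • dup W v := by
  ext <;> simp [dup] <;> ring

theorem dup_one_zero : dup W (1, 0) = (1, 0) := by
  ext <;> simp [dup]

theorem exists_norm_dup_le : ∃ C : ℝ, 0 ≤ C ∧ ∀ v, ‖dup W v‖ ≤ C * ‖v‖ ^ 4 := by
  obtain ⟨C₀, h₀, H₀⟩ := exists_norm_eval_le (W.isHomogeneous_addSubMap 0)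
  obtain ⟨C₁, h₁, H₁⟩ := exists_norm_eval_le (W.isHomogeneous_addSubMap 1)
  refine ⟨4 * max C₀ C₁, by positivity, fun v => ?_⟩
  obtain ⟨e₀, e₁, -⟩ := eval_addSubMap_diagonal W v
  have hd := norm_diagonal_le v
  have hd2 : ‖diagonal v‖ ^ 2 ≤ 4 * ‖v‖ ^ 4 := by
    calc ‖diagonal v‖ ^ 2 ≤ (2 * ‖v‖ ^ 2) ^ 2 := by gcongr
      _ = 4 * ‖v‖ ^ 4 := by ring
  refine max_le ?_ ?_
  · calc ‖(dup W v).1‖ ≤ C₀ * ‖diagonal v‖ ^ 2 := e₀ ▸ H₀ _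
      _ ≤ max C₀ C₁ * (4 * ‖v‖ ^ 4) := by gcongr; exact le_max_left _ _
      _ = _ := by ring
  · calc ‖(dup W v).2‖ ≤ C₁ * ‖diagonal v‖ ^ 2 := e₁ ▸ H₁ _
      _ ≤ max C₀ C₁ * (4 * ‖v‖ ^ 4) := by gcongr; exact le_max_right _ _
      _ = _ := by ring

/-- The lower bound for duplication: the two forms in `dup` have no common zero, which the
coefficients `WeierstrassCurve.addSubMapCoeff` make effective. No compactness is available, as `F`
need not be locally compact. -/
theorem exists_norm_pow_le_dup [W.IsElliptic] :
    ∃ C : ℝ, 0 ≤ C ∧ ∀ v, ‖v‖ ^ 4 ≤ C * ‖dup W v‖ := by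
  have key : ∀ i : Fin 3, ∃ C : ℝ, 0 ≤ C ∧ ∀ v : F × F,
      ‖diagonal v i‖ ^ 4 ≤ C * ‖v‖ ^ 4 * ‖dup W v‖ := by
    intro i
    obtain ⟨C₀, h₀, H₀⟩ :=
      exists_norm_eval_le ((W.isHomogeneous_addSubMapCoeff (i, 0)).C_mul ↑W.Δ'⁻¹)
    obtain ⟨C₁, h₁, H₁⟩ :=
      exists_norm_eval_le ((W.isHomogeneous_addSubMapCoeff (i, 1)).C_mul ↑W.Δ'⁻¹)
    refine ⟨4 * (C₀ + C₁), by positivity, fun v => ?_⟩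
    obtain ⟨e₀, e₁, e₂⟩ := eval_addSubMap_diagonal W v
    have hc := W.addSubMapCoeff_condition (diagonal v) i
    rw [Fin.sum_univ_three, e₀, e₁, e₂, mul_zero, add_zero] at hc
    have hd2 : ‖diagonal v‖ ^ 2 ≤ 4 * ‖v‖ ^ 4 := by
      calc ‖diagonal v‖ ^ 2 ≤ (2 * ‖v‖ ^ 2) ^ 2 := by gcongr; exact norm_diagonal_le v
        _ = 4 * ‖v‖ ^ 4 := by ring
    rw [← norm_pow, ← hc]
    refine (norm_add_le _ _).trans ?_
    rw [norm_mul, norm_mul]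
    calc _ ≤ C₀ * ‖diagonal v‖ ^ 2 * ‖dup W v‖ + C₁ * ‖diagonal v‖ ^ 2 * ‖dup W v‖ := by
          gcongr
          · exact H₀ _
          · exact norm_fst_le _
          · exact H₁ _
          · exact norm_snd_le _
      _ ≤ C₀ * (4 * ‖v‖ ^ 4) * ‖dup W v‖ + C₁ * (4 * ‖v‖ ^ 4) * ‖dup W v‖ := by gcongr
      _ = _ := by ring
  obtain ⟨C₀, h₀, H₀⟩ := key 0
  obtain ⟨C₂, h₂, H₂⟩ := key 2
  refine ⟨max C₀ C₂, by positivity, fun v => ?_⟩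
  rcases eq_or_ne v 0 with rfl | hv
  · rw [norm_zero, zero_pow four_ne_zero]
    positivity
  have hpos : 0 < ‖v‖ ^ 4 := by positivity
  have h8 : ‖v‖ ^ 4 * ‖v‖ ^ 4 ≤ ‖v‖ ^ 4 * (max C₀ C₂ * ‖dup W v‖) := by
    have hv' : ‖v‖ = max ‖v.1‖ ‖v.2‖ := rfl
    rcases le_total ‖v.1‖ ‖v.2‖ with h | h
    · have h2 := H₂ v
      rw [max_eq_right h] at hv'
      calc ‖v‖ ^ 4 * ‖v‖ ^ 4 = ‖diagonal v 2‖ ^ 4 := by simp [diagonal, hv']; ring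
        _ ≤ C₂ * ‖v‖ ^ 4 * ‖dup W v‖ := h2
        _ ≤ max C₀ C₂ * ‖v‖ ^ 4 * ‖dup W v‖ := by gcongr; exact le_max_right _ _
        _ = _ := by ring
    · have h2 := H₀ v
      rw [max_eq_left h] at hv'
      calc ‖v‖ ^ 4 * ‖v‖ ^ 4 = ‖diagonal v 0‖ ^ 4 := by simp [diagonal, hv']; ring
        _ ≤ C₀ * ‖v‖ ^ 4 * ‖dup W v‖ := h2
        _ ≤ max C₀ C₂ * ‖v‖ ^ 4 * ‖dup W v‖ := by gcongr; exact le_max_left _ _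
        _ = _ := by ring
  exact le_of_mul_le_mul_left h8 hpos

theorem dup_ne_zero [W.IsElliptic] {v : F × F} (hv : v ≠ 0) : dup W v ≠ 0 := by
  obtain ⟨C, -, H⟩ := exists_norm_pow_le_dup W
  intro h
  have := H v
  rw [h, norm_zero, mul_zero] at this
  have : 0 < ‖v‖ ^ 4 := by positivity
  linarith

theorem iterate_dup_ne_zero [W.IsElliptic] {v : F × F} (hv : v ≠ 0) (n : ℕ) :
    (dup W)^[n] v ≠ 0 := by
  induction n with
  | zero => exact hv
  | succ n ih => rw [Function.iterate_succ_apply']; exact dup_ne_zero W ih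

/-- The defect of `log ‖·‖` from being multiplied by `4` under duplication. -/
def defect (v : F × F) : ℝ := Real.log ‖dup W v‖ - 4 * Real.log ‖v‖

theorem exists_abs_defect_le [W.IsElliptic] : ∃ B : ℝ, ∀ v ≠ 0, |defect W v| ≤ B := by
  obtain ⟨C, hC, H⟩ := exists_norm_dup_le W
  obtain ⟨C', hC', H'⟩ := exists_norm_pow_le_dup W
  refine ⟨max (Real.log C) (Real.log C'), fun v hv => ?_⟩
  have hv1 : 0 < ‖v‖ := norm_pos_iff.2 hv
  have hd1 : 0 < ‖dup W v‖ := norm_pos_iff.2 (dup_ne_zero W hv)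
  have hCpos : 0 < C := by
    by_contra h
    have h0 : C = 0 := le_antisymm (not_lt.1 h) hC
    have := H v
    rw [h0, zero_mul] at this
    linarith
  have hCpos' : 0 < C' := by
    by_contra h
    have h0 : C' = 0 := le_antisymm (not_lt.1 h) hC'
    have := H' v
    rw [h0, zero_mul] at this
    have : 0 < ‖v‖ ^ 4 := by positivity
    linarith
  have h1 := Real.log_le_log hd1 (H v)
  have h2 := Real.log_le_log (by positivity) (H' v)
  rw [Real.log_mul hCpos.ne' (by positivity), Real.log_pow] at h1
  rw [Real.log_mul hCpos'.ne' hd1.ne', Real.log_pow] at h2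
  push_cast at h1 h2
  rw [abs_le, defect]
  constructor
  · linarith [le_max_right (Real.log C) (Real.log C')]
  · linarith [le_max_left (Real.log C) (Real.log C')]

/-- The homogeneous height on `F² ∖ {0}`: the limit of `4⁻ⁿ log ‖dupⁿ v‖`, written as a telescoping
series. -/
def homHeight (v : F × F) : ℝ :=
  Real.log ‖v‖ + ∑' n : ℕ, (1 / 4) * ((1 / 4) ^ n * defect W ((dup W)^[n] v))

theorem summable_geometric_bound (B : ℝ) :
    Summable fun n : ℕ => (1 / 4 : ℝ) * ((1 / 4) ^ n * B) :=
  ((summable_geometric_of_lt_one (by norm_num) (by norm_num)).mul_right B).mul_left _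

theorem norm_term_le {B : ℝ} (hB : ∀ v ≠ 0, |defect W v| ≤ B) [W.IsElliptic] {v : F × F}
    (hv : v ≠ 0) (n : ℕ) :
    ‖(1 / 4 : ℝ) * ((1 / 4) ^ n * defect W ((dup W)^[n] v))‖ ≤ 1 / 4 * ((1 / 4) ^ n * B) := by
  rw [norm_mul, norm_mul, Real.norm_of_nonneg (by norm_num : (0 : ℝ) ≤ 1 / 4),
    Real.norm_of_nonneg (by positivity : (0 : ℝ) ≤ (1 / 4) ^ n)]
  gcongr
  exact hB _ (iterate_dup_ne_zero W hv n)

variable [W.IsElliptic]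

theorem summable_defect {v : F × F} (hv : v ≠ 0) :
    Summable fun n : ℕ => (1 / 4 : ℝ) * ((1 / 4) ^ n * defect W ((dup W)^[n] v)) := by
  obtain ⟨B, hB⟩ := exists_abs_defect_le W
  exact Summable.of_norm_bounded (summable_geometric_bound B) (norm_term_le W hB hv)

theorem exists_abs_homHeight_sub_log_norm_le :
    ∃ B : ℝ, ∀ v ≠ 0, |homHeight W v - Real.log ‖v‖| ≤ B := by
  obtain ⟨B, hB⟩ := exists_abs_defect_le W
  refine ⟨∑' n : ℕ, (1 / 4 : ℝ) * ((1 / 4) ^ n * B), fun v hv => ?_⟩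
  rw [homHeight, add_sub_cancel_left, ← Real.norm_eq_abs]
  exact tsum_of_norm_bounded (summable_geometric_bound B).hasSum (norm_term_le W hB hv)

theorem homHeight_dup {v : F × F} (hv : v ≠ 0) : homHeight W (dup W v) = 4 * homHeight W v := by
  have h := (summable_defect W hv).tsum_eq_zero_add
  rw [homHeight, homHeight, h]
  have h2 : ∀ n : ℕ, (1 / 4 : ℝ) * ((1 / 4) ^ (n + 1) * defect W ((dup W)^[n + 1] v)) =
      (1 / 4) * ((1 / 4) * ((1 / 4) ^ n * defect W ((dup W)^[n] (dup W v)))) := fun n => by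
    rw [Function.iterate_succ_apply]; ring
  simp only [h2]
  rw [tsum_mul_left (a := (1 / 4 : ℝ))
    (f := fun n : ℕ => (1 / 4 : ℝ) * ((1 / 4) ^ n * defect W ((dup W)^[n] (dup W v)))),
    pow_zero, Function.iterate_zero, id]
  generalize (∑' n : ℕ, (1 / 4 : ℝ) * ((1 / 4) ^ n * defect W ((dup W)^[n] (dup W v)))) = S
  rw [defect]
  ring

theorem homHeight_smul {c : F} (hc : c ≠ 0) {v : F × F} (hv : v ≠ 0) :
    homHeight W (c • v) = Real.log ‖c‖ + homHeight W v := by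
  obtain ⟨B, hB⟩ := exists_abs_homHeight_sub_log_norm_le W
  -- The discrepancy is not quadrupled by `v ↦ dup v` alone: the scalar has to become `c ^ 4`.
  have := eq_zero_of_bounded_of_quadrupled (s := {p : F × F × F | p.1 ≠ 0 ∧ p.2 ≠ 0})
    (T := fun p => (p.1 ^ 4, dup W p.2))
    (D := fun p => homHeight W (p.1 • p.2) - Real.log ‖p.1‖ - homHeight W p.2) (B := B + B)
    (fun p hp => ⟨pow_ne_zero _ hp.1, dup_ne_zero W hp.2⟩)
    (fun p hp => by
      have h1 := hB _ (smul_ne_zero hp.1 hp.2)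
      have h2 := hB _ hp.2
      rw [norm_smul, Real.log_mul (norm_ne_zero_iff.2 hp.1) (norm_ne_zero_iff.2 hp.2)] at h1
      rw [abs_le] at *
      constructor <;> linarith [h1.1, h1.2, h2.1, h2.2])
    (fun p hp => by
      simp only
      rw [← dup_smul, homHeight_dup W (smul_ne_zero hp.1 hp.2), homHeight_dup W hp.2, norm_pow,
        Real.log_pow]
      push_cast
      ring)
    (a := (c, v)) ⟨hc, hv⟩
  simp only at this
  linarith

theorem homHeight_one_zero : homHeight W (1, 0) = 0 := by
  have h : ((1, 0) : F × F) ≠ 0 := by simp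
  have := homHeight_dup W h
  rw [dup_one_zero] at this
  linarith

theorem continuousOn_homHeight : ContinuousOn (homHeight W) {v | v ≠ 0} := by
  obtain ⟨B, hB⟩ := exists_abs_defect_le W
  have hlog : ∀ f : F × F → F × F, Continuous f → (∀ v ≠ 0, f v ≠ 0) →
      ContinuousOn (fun v => Real.log ‖f v‖) {v | v ≠ 0} := fun f hf h0 =>
    hf.norm.continuousOn.log fun v hv => norm_ne_zero_iff.2 (h0 v hv)
  refine (hlog id continuous_id fun v hv => hv).add ?_
  refine continuousOn_tsum (fun n => ?_) (summable_geometric_bound B)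
    (fun n v hv => norm_term_le W hB hv n)
  refine continuousOn_const.mul (continuousOn_const.mul ?_)
  have hit : Continuous (dup W)^[n] := (continuous_dup W).iterate n
  exact (hlog _ ((continuous_dup W).comp hit)
      fun v hv => dup_ne_zero W (iterate_dup_ne_zero W hv n)).sub
    (continuousOn_const.mul (hlog _ hit fun v hv => iterate_dup_ne_zero W hv n))

theorem homHeight_map {K : Type*} [NormedField K] (φ : F →+* K) (hφ : ∀ a, ‖φ a‖ = ‖a‖)
    {W' : WeierstrassCurve.Affine K} [W'.IsElliptic] (hW : W' = W.map φ) {v : F × F}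
    (hv : v ≠ 0) : homHeight W' (φ v.1, φ v.2) = homHeight W v := by
  obtain ⟨B, hB⟩ := exists_abs_homHeight_sub_log_norm_le W
  obtain ⟨B', hB'⟩ := exists_abs_homHeight_sub_log_norm_le W'
  have hnorm : ∀ v : F × F, ‖(φ v.1, φ v.2)‖ = ‖v‖ := fun v => by
    rw [Prod.norm_def, Prod.norm_def, hφ, hφ]
  have hne : ∀ v : F × F, v ≠ 0 → (φ v.1, φ v.2) ≠ 0 := fun v hv => by
    rw [← norm_ne_zero_iff, hnorm]; exact norm_ne_zero_iff.2 hv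
  have hdup : ∀ v : F × F, (φ (dup W v).1, φ (dup W v).2) = dup W' (φ v.1, φ v.2) := fun v => by
    subst hW
    ext <;> simp [dup, map_ofNat φ]
  have := eq_zero_of_bounded_of_quadrupled (s := {v : F × F | v ≠ 0}) (T := dup W)
    (D := fun v => homHeight W' (φ v.1, φ v.2) - homHeight W v) (B := B' + B)
    (fun v hv => dup_ne_zero W hv)
    (fun v hv => by
      have h1 := hB' _ (hne v hv)
      have h2 := hB _ hv
      rw [hnorm] at h1
      rw [abs_le] at *
      constructor <;> linarith [h1.1, h1.2, h2.1, h2.2])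
    (fun v hv => by
      rw [hdup, homHeight_dup W' (hne v hv), homHeight_dup W hv]
      ring)
    hv
  linarith

end HomogeneousHeight

/-! ### Sizes of coordinates and the topology of the points -/

section Estimates

variable {F : Type*} [NormedField F] (W : WeierstrassCurve.Affine F)

theorem exists_norm_y_le (R : ℝ) :
    ∃ R' : ℝ, ∀ x y : F, W.Equation x y → ‖x‖ ≤ R → ‖y‖ ≤ R' := by
  set A : ℝ := ‖W.a₁‖ * |R| + ‖W.a₃‖
  set B : ℝ := |R| ^ 3 + ‖W.a₂‖ * |R| ^ 2 + ‖W.a₄‖ * |R| + ‖W.a₆‖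
  have hA : 0 ≤ A := by positivity
  have hB : 0 ≤ B := by positivity
  refine ⟨A + B + 1, fun x y h hx => ?_⟩
  replace hx : ‖x‖ ≤ |R| := hx.trans (le_abs_self R)
  rw [WeierstrassCurve.Affine.equation_iff] at h
  have h1 : ‖y‖ ^ 2 ≤ B + A * ‖y‖ := by
    have e : y ^ 2 = x ^ 3 + W.a₂ * x ^ 2 + W.a₄ * x + W.a₆ - (W.a₁ * x + W.a₃) * y := by
      linear_combination h
    rw [← norm_pow, e]
    refine (norm_sub_le _ _).trans (add_le_add ?_ ?_)
    · refine (norm_add_le _ _).trans (add_le_add ((norm_add_le _ _).trans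
        (add_le_add ((norm_add_le _ _).trans (add_le_add ?_ ?_)) ?_)) le_rfl)
      · rw [norm_pow]; gcongr
      · rw [norm_mul, norm_pow]; gcongr
      · rw [norm_mul]; gcongr
    · rw [norm_mul]
      gcongr
      refine (norm_add_le _ _).trans (add_le_add ?_ le_rfl)
      rw [norm_mul]; gcongr
  by_contra hy
  rw [not_le] at hy
  nlinarith [norm_nonneg y]

/-- Near `∞` the sizes of `x³` and `y²` are comparable. -/
theorem exists_norm_x_cube_le : ∃ R : ℝ, 1 ≤ R ∧ ∀ x y : F, W.Equation x y → R ≤ ‖x‖ →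
    ‖x‖ ^ 3 ≤ 4 * ‖y‖ ^ 2 ∧ ‖y‖ ^ 2 ≤ 4 * ‖x‖ ^ 3 := by
  set M : ℝ := 1 + ‖W.a₁‖ + ‖W.a₂‖ + ‖W.a₃‖ + ‖W.a₄‖ + ‖W.a₆‖
  have n1 := norm_nonneg W.a₁
  have n2 := norm_nonneg W.a₂
  have n3 := norm_nonneg W.a₃
  have n4 := norm_nonneg W.a₄
  have n6 := norm_nonneg W.a₆
  have hM : 1 ≤ M := by simp only [M]; linarith
  refine ⟨8 * M ^ 2, by nlinarith, fun x y h hx => ?_⟩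
  rw [WeierstrassCurve.Affine.equation_iff] at h
  have hx1 : 1 ≤ ‖x‖ := by nlinarith
  have hx2 : ‖x‖ ≤ ‖x‖ ^ 2 := by nlinarith
  have hy0 := norm_nonneg y
  set q : F := W.a₂ * x ^ 2 + W.a₄ * x + W.a₆ with hq
  set l : F := (W.a₁ * x + W.a₃) * y with hl
  have hqn : ‖q‖ ≤ M * ‖x‖ ^ 2 := by
    have h1 : ‖q‖ ≤ ‖W.a₂‖ * ‖x‖ ^ 2 + ‖W.a₄‖ * ‖x‖ + ‖W.a₆‖ := by
      refine (norm_add_le _ _).trans (add_le_add ((norm_add_le _ _).trans (add_le_add ?_ ?_)) le_rfl)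
      · rw [norm_mul, norm_pow]
      · rw [norm_mul]
    have h2 : ‖W.a₄‖ * ‖x‖ ≤ ‖W.a₄‖ * ‖x‖ ^ 2 := by gcongr
    have h3 : ‖W.a₆‖ ≤ ‖W.a₆‖ * ‖x‖ ^ 2 := le_mul_of_one_le_right n6 (hx1.trans hx2)
    have h4 : (‖W.a₂‖ + ‖W.a₄‖ + ‖W.a₆‖) * ‖x‖ ^ 2 ≤ M * ‖x‖ ^ 2 := by
      gcongr
      simp only [M]; linarith
    linarith
  have hln : ‖l‖ ≤ M * ‖x‖ * ‖y‖ := by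
    rw [hl, norm_mul]
    gcongr
    have h1 : ‖W.a₁ * x + W.a₃‖ ≤ ‖W.a₁‖ * ‖x‖ + ‖W.a₃‖ := by
      refine (norm_add_le _ _).trans (add_le_add ?_ le_rfl)
      rw [norm_mul]
    have h3 : ‖W.a₃‖ ≤ ‖W.a₃‖ * ‖x‖ := le_mul_of_one_le_right n3 hx1
    have h4 : (‖W.a₁‖ + ‖W.a₃‖) * ‖x‖ ≤ M * ‖x‖ := by
      gcongr
      simp only [M]; linarith
    linarith
  have e1 : ‖x‖ ^ 3 ≤ ‖y‖ ^ 2 + ‖l‖ + ‖q‖ := by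
    have : x ^ 3 = y ^ 2 + l - q := by rw [hl, hq]; linear_combination -h
    rw [← norm_pow, this, ← norm_pow]
    exact (norm_sub_le _ _).trans (add_le_add (norm_add_le _ _) le_rfl)
  have e2 : ‖y‖ ^ 2 ≤ ‖x‖ ^ 3 + ‖q‖ + ‖l‖ := by
    have : y ^ 2 = x ^ 3 + q - l := by rw [hl, hq]; linear_combination h
    rw [← norm_pow, this, ← norm_pow]
    exact (norm_sub_le _ _).trans (add_le_add (norm_add_le _ _) le_rfl)
  -- The mixed term is absorbed by `2ab ≤ a² + b²`.
  have hamgm : M * ‖x‖ * ‖y‖ ≤ ‖y‖ ^ 2 / 2 + M ^ 2 * ‖x‖ ^ 2 / 2 := by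
    nlinarith [sq_nonneg (‖y‖ - M * ‖x‖)]
  have hcub : 8 * M ^ 2 * ‖x‖ ^ 2 ≤ ‖x‖ ^ 3 := by
    nlinarith [mul_le_mul_of_nonneg_right hx (sq_nonneg ‖x‖)]
  have hMM : M * ‖x‖ ^ 2 ≤ M ^ 2 * ‖x‖ ^ 2 := by
    gcongr
    nlinarith
  have hM2 : 0 ≤ M ^ 2 * ‖x‖ ^ 2 := by positivity
  constructor <;> nlinarith

/-- Points with large `x` have homogeneous coordinates close to `[0 : 1 : 0]`. -/
theorem exists_coords_mem_of_lt_norm_x {U : Set (Fin 3 → F)}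
    (hU : U ∈ 𝓝 (coords (0 : W.Point))) : ∃ R : ℝ, ∀ x y : F, W.Equation x y → R < ‖x‖ →
      y ≠ 0 ∧ ![x / y, 1, 1 / y] ∈ U := by
  obtain ⟨ε, hε, hball⟩ := Metric.mem_nhds_iff.1 hU
  obtain ⟨R, hR1, hR⟩ := exists_norm_x_cube_le W
  refine ⟨max R (4 / ε ^ 2 + 1), fun x y hxy hx => ?_⟩
  obtain ⟨hx1, hx2⟩ := max_lt_iff.1 hx
  obtain ⟨h1, -⟩ := hR x y hxy hx1.le
  have hxpos : 0 < ‖x‖ := by linarith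
  have hy0 : y ≠ 0 := by
    rintro rfl
    have : 0 < ‖x‖ ^ 3 := by positivity
    simp at h1
    linarith
  have hypos : 0 < ‖y‖ := norm_pos_iff.2 hy0
  have hxy' : ‖x‖ / ‖y‖ < ε := by
    rw [div_lt_iff₀ hypos]
    refine lt_of_pow_lt_pow_left₀ 2 (by positivity) ?_
    have h2 : 4 < ‖x‖ * ε ^ 2 := by
      have : 4 / ε ^ 2 < ‖x‖ := by linarith
      rwa [div_lt_iff₀ (by positivity)] at this
    have h3 : 4 * ‖x‖ ^ 2 < ε ^ 2 * ‖x‖ ^ 3 := by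
      have : 0 < ‖x‖ ^ 2 := by positivity
      nlinarith
    have h4 : ε ^ 2 * ‖x‖ ^ 3 ≤ ε ^ 2 * (4 * ‖y‖ ^ 2) := by gcongr
    rw [mul_pow]
    linarith
  have h1y : 1 / ‖y‖ < ε := by
    refine lt_of_le_of_lt ?_ hxy'
    gcongr
    linarith
  refine ⟨hy0, hball ?_⟩
  rw [Metric.mem_ball, dist_pi_lt_iff hε]
  intro i
  change dist _ ((coords (W := W) .zero) i) < ε
  fin_cases i
  · simpa [coords] using hxy'
  · simpa [coords] using hε
  · simpa [coords] using h1y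

end Estimates

section PointTopology

variable {F : Type*} [NormedField F] {W : WeierstrassCurve.Affine F}

theorem isOpen_points_iff {U : Set W.Point} : IsOpen U ↔
    ∃ t : Set (Projectivization F (Fin 3 → F)),
      IsOpen ((fun v : {v : Fin 3 → F // v ≠ 0} => Projectivization.mk F v.1 v.2) ⁻¹' t) ∧
      toProjectivePlane ⁻¹' t = U :=
  Iff.rfl

theorem isOpen_setOf_coords_mem {s : Set (Fin 3 → F)} (hs : IsOpen s)
    (hinv : ∀ c : F, c ≠ 0 → ∀ v ∈ s, c • v ∈ s) : IsOpen {Q : W.Point | coords Q ∈ s} := by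
  have hrep : ∀ (v : Fin 3 → F) (hv : v ≠ 0), (Projectivization.mk F v hv).rep ∈ s ↔ v ∈ s := by
    intro v hv
    obtain ⟨a, ha⟩ := Projectivization.exists_smul_eq_mk_rep F v hv
    rw [← ha]
    refine ⟨fun h => ?_, fun h => hinv a a.ne_zero v h⟩
    have := hinv (a⁻¹ : Fˣ) (a⁻¹).ne_zero _ h
    rwa [← Units.smul_def, inv_smul_smul] at this
  refine isOpen_points_iff.2 ⟨{p | p.rep ∈ s}, ?_, ?_⟩
  · have : (fun v : {v : Fin 3 → F // v ≠ 0} => Projectivization.mk F v.1 v.2) ⁻¹'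
        {p | p.rep ∈ s} = Subtype.val ⁻¹' s := by
      ext v
      exact hrep v.1 v.2
    rw [this]
    exact hs.preimage continuous_subtype_val
  · ext Q
    exact hrep _ _

theorem eventually_mem_of_coords_eq_smul {Q : W.Point} {U : Set W.Point} (hU : U ∈ 𝓝 Q) :
    ∀ᶠ v in 𝓝 (coords Q), ∀ (Q' : W.Point) (c : F), c ≠ 0 → coords Q' = c • v → Q' ∈ U := by
  obtain ⟨O, hOU, hO, hQ⟩ := mem_nhds_iff.1 hU
  obtain ⟨t, ht, rfl⟩ := isOpen_points_iff.1 hO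
  obtain ⟨V, hV, hVt⟩ := isOpen_induced_iff.1 ht
  have hmem : ∀ v (hv : v ≠ 0), v ∈ V ↔ Projectivization.mk F v hv ∈ t := fun v hv =>
    Set.ext_iff.1 hVt ⟨v, hv⟩
  filter_upwards [hV.mem_nhds ((hmem _ (coords_ne_zero Q)).2 hQ)] with v hv Q' c hc hQ'
  refine hOU ?_
  have hv0 : v ≠ 0 := by
    rintro rfl
    exact coords_ne_zero Q' (by rw [hQ', smul_zero])
  have : toProjectivePlane Q' = Projectivization.mk F v hv0 := by
    rw [toProjectivePlane, Projectivization.mk_eq_mk_iff']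
    exact ⟨c, hQ'.symm⟩
  rw [Set.mem_preimage, this]
  exact (hmem v hv0).1 hv

theorem continuous_xCoord : Continuous fun Q : AffinePoint W => xCoord Q.1 := by
  rw [continuous_def]
  intro O hO
  have hopen : IsOpen {v : Fin 3 → F | v 2 ≠ 0 ∧ v 0 / v 2 ∈ O} := by
    have hc : ContinuousOn (fun v : Fin 3 → F => v 0 / v 2) {v | v 2 ≠ 0} :=
      (continuous_apply 0).continuousOn.div (continuous_apply 2).continuousOn fun v hv => hv
    exact hc.isOpen_inter_preimage
      (isOpen_ne.preimage (continuous_apply (A := fun _ : Fin 3 => F) 2)) hO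
  have := isOpen_setOf_coords_mem (W := W) hopen fun c hc v hv =>
    ⟨mul_ne_zero hc hv.1, by simpa [mul_div_mul_left _ _ hc] using hv.2⟩
  convert this.preimage (continuous_subtype_val (p := fun Q : W.Point => Q ≠ 0)) using 1
  ext ⟨Q, hQ⟩
  cases Q with
  | zero => exact absurd rfl hQ
  | some x y h => simp [coords, xCoord]

theorem eventually_lt_norm_xCoord (R : ℝ) :
    ∀ᶠ Q : W.Point in 𝓝 0, Q = 0 ∨ R < ‖xCoord Q‖ := by
  obtain ⟨R', hR'⟩ := exists_norm_y_le W R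
  have hopen : IsOpen {v : Fin 3 → F | ‖v 2‖ * |R'| < ‖v 1‖} :=
    isOpen_lt (by fun_prop) (by fun_prop)
  have := isOpen_setOf_coords_mem (W := W) hopen fun c hc v hv => by
    have hc' : 0 < ‖c‖ := norm_pos_iff.2 hc
    simp only [Set.mem_ofPred_eq, Pi.smul_apply, smul_eq_mul, norm_mul] at hv ⊢
    rw [mul_assoc]
    exact mul_lt_mul_of_pos_left hv hc'
  have h0 : (0 : W.Point) ∈ {Q : W.Point | coords Q ∈ {v : Fin 3 → F | ‖v 2‖ * |R'| < ‖v 1‖}} := by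
    change ‖(coords (W := W) .zero) 2‖ * |R'| < ‖(coords (W := W) .zero) 1‖
    simp [coords]
  filter_upwards [this.mem_nhds h0] with Q hQ
  cases Q with
  | zero => exact Or.inl rfl
  | some x y h =>
    right
    by_contra hx
    have h1 := hR' x y h.1 (not_lt.1 hx)
    simp [coords] at hQ
    linarith [le_abs_self R']

/-- Points with large `x` are close to `∞`. -/
theorem exists_norm_xCoord_le_of_notMem {N : Set W.Point} (hN : N ∈ 𝓝 (0 : W.Point)) :
    ∃ C : ℝ, ∀ Q : W.Point, Q ∉ N → ‖xCoord Q‖ ≤ C := by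
  have h := eventually_mem_of_coords_eq_smul hN
  obtain ⟨R, hR⟩ := exists_coords_mem_of_lt_norm_x W h
  refine ⟨R, fun Q hQ => ?_⟩
  by_contra hx
  refine hQ ?_
  cases Q with
  | zero => exact mem_of_mem_nhds hN
  | some x y hxy =>
    obtain ⟨hy0, hmem⟩ := hR x y hxy.1 (not_le.1 hx)
    refine hmem _ y hy0 ?_
    ext i
    fin_cases i <;> simp [coords] <;> field_simp

end PointTopology

/-! ### Existence of the local height -/

section LocalHeightExistence

variable {F : Type*} [NormedField F] (W : WeierstrassCurve.Affine F) [W.IsElliptic]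

/-- Half the homogeneous height of the `x`-coordinate; it is shown to be the local height. -/
def halfHeight (Q : AffinePoint W) : ℝ := 1 / 2 * homHeight W (xCoord Q.1, 1)

theorem pair_one_ne_zero (x : F) : ((x, 1) : F × F) ≠ 0 := by simp

variable {W}

theorem homHeight_of_psi_ne_zero {x y : F} (h : W.Equation x y) (hψ : psi W x y ≠ 0) :
    homHeight W (phi W x / psi W x y ^ 2, 1) =
      4 * homHeight W (x, 1) - 2 * Real.log ‖psi W x y‖ := by
  have e : dup W (x, 1) = psi W x y ^ 2 • ((phi W x / psi W x y ^ 2, 1) : F × F) := by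
    ext
    · simp [dup, phi]; field_simp
    · simp [dup, psi_sq h]
  have h1 := homHeight_dup W (pair_one_ne_zero x)
  rw [e, homHeight_smul W (pow_ne_zero 2 hψ) (pair_one_ne_zero _), norm_pow, Real.log_pow] at h1
  push_cast at h1
  linarith

theorem homHeight_of_psi_eq_zero {x y : F} (h : W.Nonsingular x y) (hψ : psi W x y = 0) :
    2 * homHeight W (x, 1) = Real.log ‖tangentNum W x y‖ := by
  have hN := tangentNum_ne_zero h hψ
  have e : dup W (x, 1) = tangentNum W x y ^ 2 • ((1, 0) : F × F) := by
    have := psi_sq h.1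
    rw [hψ] at this
    ext
    · simp [dup, ← phi_of_psi_eq_zero h.1 hψ, phi]
    · simp [dup, ← this]
  have h1 := homHeight_dup W (pair_one_ne_zero x)
  rw [e, homHeight_smul W (pow_ne_zero 2 hN) (by simp), norm_pow, Real.log_pow,
    homHeight_one_zero] at h1
  push_cast at h1
  linarith

theorem isLocalHeight_halfHeight : IsLocalHeight (halfHeight W) where
  continuous := by
    refine continuous_const.mul ((continuousOn_homHeight W).comp_continuous
      (continuous_xCoord.prodMk continuous_const) fun Q => pair_one_ne_zero _)
  bounded := by
    intro N hN
    obtain ⟨C, hC⟩ := exists_norm_xCoord_le_of_notMem hN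
    obtain ⟨B, hB⟩ := exists_abs_homHeight_sub_log_norm_le W
    refine ⟨1 / 2 * (B + Real.log (max C 1)), fun Q hQ => ?_⟩
    have h1 := hB _ (pair_one_ne_zero (xCoord Q.1))
    have hn : ‖((xCoord Q.1, 1) : F × F)‖ = max ‖xCoord Q.1‖ 1 := by simp [Prod.norm_def]
    rw [hn] at h1
    have h2 : 0 ≤ Real.log (max ‖xCoord Q.1‖ 1) := Real.log_nonneg (le_max_right _ _)
    have h3 : Real.log (max ‖xCoord Q.1‖ 1) ≤ Real.log (max C 1) :=
      Real.log_le_log (by positivity) (max_le_max_right _ (hC _ hQ))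
    rw [halfHeight, abs_mul, abs_of_pos (by norm_num : (0 : ℝ) < 1 / 2)]
    gcongr
    rw [abs_le] at *
    constructor <;> linarith [h1.1, h1.2]
  limit := by
    refine ⟨0, ?_⟩
    have hx : Filter.Tendsto (fun Q : AffinePoint W => ‖xCoord Q.1‖)
        (Filter.comap Subtype.val (𝓝 (0 : W.Point))) Filter.atTop := by
      refine Filter.tendsto_atTop.2 fun R => ?_
      filter_upwards [Filter.preimage_mem_comap (eventually_lt_norm_xCoord (W := W) R)] with Q hQ
      exact (hQ.resolve_left Q.2).le
    have hinv : Filter.Tendsto (fun Q : AffinePoint W => (xCoord Q.1)⁻¹)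
        (Filter.comap Subtype.val (𝓝 (0 : W.Point))) (𝓝 0) := by
      rw [tendsto_zero_iff_norm_tendsto_zero]
      simp only [norm_inv]
      exact tendsto_inv_atTop_zero.comp hx
    have hcont : ContinuousAt (homHeight W) (1, 0) :=
      (continuousOn_homHeight W).continuousAt (isOpen_ne.mem_nhds (by simp))
    have h1 := (hcont.tendsto.comp (tendsto_const_nhds.prodMk_nhds hinv)).const_mul (1 / 2 : ℝ)
    rw [homHeight_one_zero, mul_zero] at h1
    refine h1.congr' ?_
    filter_upwards [hx.eventually (Filter.eventually_gt_atTop 0)] with Q hQ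
    have hx0 : xCoord Q.1 ≠ 0 := norm_pos_iff.1 hQ
    have e : ((xCoord Q.1, 1) : F × F) = xCoord Q.1 • ((1, (xCoord Q.1)⁻¹) : F × F) := by
      ext <;> simp [hx0]
    rw [halfHeight, e, homHeight_smul W hx0 (by simp)]
    simp only [Function.comp]
    ring
  duplication := by
    classical
    rintro ⟨Q, hQ⟩ h
    cases Q with
    | zero => exact absurd rfl hQ
    | some x y hxy =>
      have hψ : psi W x y ≠ 0 := fun h0 => h (two_nsmul_of_psi_eq_zero hxy h0)
      obtain ⟨h', e⟩ := two_nsmul_of_psi_ne_zero hxy hψ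
      have hx : xCoord ((2 : ℕ) • WeierstrassCurve.Affine.Point.some x y hxy) =
          phi W x / psi W x y ^ 2 := by rw [e]; rfl
      simp only [halfHeight]
      rw [hx, homHeight_of_psi_ne_zero hxy.1 hψ]
      simp only [xCoord, yCoord, psi]
      ring

end LocalHeightExistence

/-! ### Uniqueness of the local height -/

section LocalHeightUniqueness

open Classical in
theorem finite_two_torsion {F : Type*} [Field F] [CharZero F] (W : WeierstrassCurve.Affine F) :
    {Q : W.Point | (2 : ℕ) • Q = 0}.Finite := by
  have hfin : {x : F | (WeierstrassCurve.twoTorsionPolynomial W).toPoly.IsRoot x}.Finite := by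
    refine Polynomial.finite_setOfPred_isRoot (Cubic.ne_zero_of_a_ne_zero ?_)
    simp [WeierstrassCurve.twoTorsionPolynomial]
  have : ({Q : W.Point | (2 : ℕ) • Q = 0} \ {0}).Finite := by
    refine Set.Finite.of_injOn (f := xCoord) ?_ ?_ hfin
    · rintro Q ⟨hQ, hQ0⟩
      cases Q with
      | zero => exact absurd rfl hQ0
      | some x y h =>
        have hψ := (two_nsmul_some_eq_zero_iff h).1 hQ
        have := psi_sq h.1
        rw [hψ] at this
        simp [WeierstrassCurve.twoTorsionPolynomial, Cubic.toPoly, xCoord, ← this]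
    · rintro Q ⟨hQ, hQ0⟩ Q' ⟨hQ', hQ0'⟩ hx
      cases Q with
      | zero => exact absurd rfl hQ0
      | some x y h =>
        cases Q' with
        | zero => exact absurd rfl hQ0'
        | some x' y' h' =>
          have hψ := (two_nsmul_some_eq_zero_iff h).1 hQ
          have hψ' := (two_nsmul_some_eq_zero_iff h').1 hQ'
          obtain rfl : x = x' := hx
          rw [psi] at hψ hψ'
          have : y = y' := mul_left_cancel₀ (two_ne_zero (α := F)) (by linear_combination hψ - hψ')
          subst this
          rfl
  exact this.of_sdiff (Set.finite_singleton 0)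

open Classical in
theorem finite_two_pow_torsion {F : Type*} [Field F] [CharZero F] (W : WeierstrassCurve.Affine F)
    (n : ℕ) : {Q : W.Point | (2 ^ n : ℕ) • Q = 0}.Finite := by
  induction n with
  | zero => simp
  | succ n ih =>
    have hpre : {Q : W.Point | (2 ^ (n + 1) : ℕ) • Q = 0} =
        (fun Q => (2 : ℕ) • Q) ⁻¹' {Q : W.Point | (2 ^ n : ℕ) • Q = 0} := by
      ext Q
      simp [pow_succ, mul_nsmul']
    rw [hpre]
    refine ih.preimage' fun P _ => ?_
    rcases Set.eq_empty_or_nonempty ((fun Q : W.Point => (2 : ℕ) • Q) ⁻¹' {P}) with h | ⟨Q₀, h₀⟩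
    · rw [h]; exact Set.finite_empty
    · refine ((finite_two_torsion W).image (fun T => Q₀ + T)).subset fun Q hQ => ?_
      have h₀' : (2 : ℕ) • Q₀ = P := h₀
      have hQ' : (2 : ℕ) • Q = P := hQ
      refine ⟨Q - Q₀, ?_, add_sub_cancel Q₀ Q⟩
      change (2 : ℕ) • (Q - Q₀) = 0
      rw [nsmul_sub, hQ', h₀', sub_self]

/-- Over a complete field no affine point is isolated: by the inverse function theorem, one of the
coordinates takes all values near the given one. -/
theorem infinite_of_mem_nhds_point {F : Type*} [NontriviallyNormedField F] [CompleteSpace F]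
    {W : WeierstrassCurve.Affine F} [W.IsElliptic] {x₀ y₀ : F} (h : W.Nonsingular x₀ y₀)
    {U : Set W.Point} (hU : U ∈ 𝓝 (WeierstrassCurve.Affine.Point.some x₀ y₀ h)) :
    U.Infinite := by
  set w : F × F → F := fun p => p.2 ^ 2 + W.a₁ * p.1 * p.2 + W.a₃ * p.2 -
    (p.1 ^ 3 + W.a₂ * p.1 ^ 2 + W.a₄ * p.1 + W.a₆) with hw
  have hw0 : w (x₀, y₀) = 0 := sub_eq_zero.2 ((WeierstrassCurve.Affine.equation_iff ..).1 h.1)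
  have hV : ∀ᶠ p : F × F in 𝓝 (x₀, y₀), ∀ h' : W.Nonsingular p.1 p.2,
      WeierstrassCurve.Affine.Point.some p.1 p.2 h' ∈ U := by
    have hc : Continuous fun p : F × F => (![p.1, p.2, 1] : Fin 3 → F) := by fun_prop
    have := hc.tendsto (x₀, y₀)
    filter_upwards [this.eventually (eventually_mem_of_coords_eq_smul hU)] with p hp h'
    exact hp _ 1 one_ne_zero (by rw [one_smul]; rfl)
  have hderiv : HasStrictFDerivAt w
      ((-tangentNum W x₀ y₀) • ContinuousLinearMap.fst F F F +
        psi W x₀ y₀ • ContinuousLinearMap.snd F F F) (x₀, y₀) := by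
    have h1 : HasStrictFDerivAt (fun p : F × F => p.1) (ContinuousLinearMap.fst F F F) (x₀, y₀) :=
      hasStrictFDerivAt_fst
    have h2 : HasStrictFDerivAt (fun p : F × F => p.2) (ContinuousLinearMap.snd F F F) (x₀, y₀) :=
      hasStrictFDerivAt_snd
    have := (((h2.pow 2).add ((h1.const_mul W.a₁).mul h2)).add (h2.const_mul W.a₃)).sub
      ((((h1.pow 3).add ((h1.pow 2).const_mul W.a₂)).add (h1.const_mul W.a₄)).add_const W.a₆)
    refine this.congr_fderiv ?_
    ext
    · simp [tangentNum]; ring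
    · simp [psi]
  have hns : ∀ p : F × F, w p = 0 → W.Nonsingular p.1 p.2 := fun p hp =>
    (WeierstrassCurve.Affine.equation_iff_nonsingular).1
      ((WeierstrassCurve.Affine.equation_iff ..).2 (sub_eq_zero.1 hp))
  by_cases hψ : psi W x₀ y₀ = 0
  · have hN := tangentNum_ne_zero h hψ
    have hmap := (hasStrictFDerivAt_snd.prodMk hderiv).map_nhds_eq_of_surj (by
      refine LinearMap.range_eq_top.2 fun q => ⟨(-q.2 / tangentNum W x₀ y₀, q.1), ?_⟩
      ext
      · simp
      · simp [hψ]; field_simp)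
    have himg := Filter.image_mem_map (m := fun p : F × F => (p.2, w p)) hV
    rw [hmap, hw0] at himg
    have hinf := infinite_of_mem_nhds y₀
      ((Continuous.prodMk_left (X := F) (0 : F)).tendsto y₀ himg)
    intro hfin
    refine hinf ((hfin.image yCoord).subset ?_)
    rintro s ⟨p, hp, e⟩
    obtain ⟨e1, e2⟩ := Prod.ext_iff.1 e
    exact ⟨_, hp (hns p e2), e1⟩
  · have hmap := (hasStrictFDerivAt_fst.prodMk hderiv).map_nhds_eq_of_surj (by
      refine LinearMap.range_eq_top.2 fun q =>
        ⟨(q.1, (q.2 + tangentNum W x₀ y₀ * q.1) / psi W x₀ y₀), ?_⟩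
      ext
      · simp
      · simp; field_simp; ring)
    have himg := Filter.image_mem_map (m := fun p : F × F => (p.1, w p)) hV
    rw [hmap, hw0] at himg
    have hinf := infinite_of_mem_nhds x₀
      ((Continuous.prodMk_left (X := F) (0 : F)).tendsto x₀ himg)
    intro hfin
    refine hinf ((hfin.image xCoord).subset ?_)
    rintro s ⟨p, hp, e⟩
    obtain ⟨e1, e2⟩ := Prod.ext_iff.1 e
    exact ⟨_, hp (hns p e2), e1⟩

/-- The difference of two local heights is bounded and quadrupled by duplication, hence small at
points that no small power of two kills; every neighbourhood contains such points, being infinite.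
-/
theorem IsLocalHeight.unique {F : Type*} [NontriviallyNormedField F] [CompleteSpace F] [CharZero F]
    {W : WeierstrassCurve.Affine F} [W.IsElliptic] {lam lam' : AffinePoint W → ℝ}
    (h : IsLocalHeight lam) (h' : IsLocalHeight lam') : lam = lam' := by
  classical
  set D : AffinePoint W → ℝ := fun Q => lam Q - lam' Q with hD
  have hDcont : Continuous D := h.continuous.sub h'.continuous
  have hdup : ∀ (Q : AffinePoint W) (h2 : (2 : ℕ) • Q.1 ≠ 0), D ⟨(2 : ℕ) • Q.1, h2⟩ = 4 * D Q := by
    intro Q h2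
    simp only [hD]
    rw [h.duplication, h'.duplication]
    ring
  obtain ⟨B, hB⟩ : ∃ B : ℝ, ∀ Q, |D Q| ≤ B := by
    obtain ⟨c, hc⟩ := h.limit
    obtain ⟨c', hc'⟩ := h'.limit
    have hlim : Filter.Tendsto D (Filter.comap Subtype.val (𝓝 (0 : W.Point))) (𝓝 (c - c')) :=
      (hc.sub hc').congr fun Q => by simp only [hD]; ring
    obtain ⟨N, hN, hsub⟩ := Filter.mem_comap.1 (hlim (Metric.ball_mem_nhds _ one_pos))
    obtain ⟨C, hC⟩ := h.bounded N hN
    obtain ⟨C', hC'⟩ := h'.bounded N hN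
    refine ⟨max (|c - c'| + 1) (C + C'), fun Q => ?_⟩
    by_cases hQ : Q.1 ∈ N
    · have h1 : |D Q - (c - c')| < 1 := hsub hQ
      refine le_trans ?_ (le_max_left _ _)
      have := abs_add_le (D Q - (c - c')) (c - c')
      rw [sub_add_cancel] at this
      linarith
    · refine le_trans ?_ (le_max_right _ _)
      exact (abs_sub _ _).trans (add_le_add (hC Q hQ) (hC' Q hQ))
  have hpow : ∀ (n : ℕ) (Q : AffinePoint W), (2 ^ n : ℕ) • Q.1 ≠ 0 → (4 : ℝ) ^ n * |D Q| ≤ B := by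
    intro n
    induction n with
    | zero => intro Q _; simpa using hB Q
    | succ n ih =>
      intro Q hQ
      rw [pow_succ, mul_nsmul'] at hQ
      have h2 : (2 : ℕ) • Q.1 ≠ 0 := fun h0 => hQ (by rw [h0, nsmul_zero])
      have := ih ⟨_, h2⟩ hQ
      rw [hdup, abs_mul, abs_of_pos (by norm_num : (0 : ℝ) < 4)] at this
      rw [pow_succ, mul_assoc]
      exact this
  funext Q
  by_contra hne
  have hpos : 0 < |D Q| := abs_pos.2 (sub_ne_zero.2 hne)
  obtain ⟨n, hn⟩ := pow_unbounded_of_one_lt (2 * B / |D Q|) (by norm_num : (1 : ℝ) < 4)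
  rw [div_lt_iff₀ hpos] at hn
  have hU : ∀ᶠ Q' in 𝓝 Q, |D Q| / 2 < |D Q'| :=
    (hDcont.abs.tendsto Q).eventually (lt_mem_nhds (by linarith))
  obtain ⟨N, hN, hsub⟩ := (mem_nhds_induced _ Q _).1 hU
  obtain ⟨Q, hQ⟩ := Q
  cases Q with
  | zero => exact hQ rfl
  | some x y hxy =>
    refine infinite_of_mem_nhds_point hxy hN
      (((finite_two_pow_torsion W n).union (Set.finite_singleton 0)).subset fun P hP => ?_)
    by_contra hPn
    simp only [Set.mem_union, Set.mem_ofPred_eq, Set.mem_singleton_iff, not_or] at hPn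
    have h1 := hpow n ⟨P, hPn.2⟩ hPn.1
    have h2 : _ < |D ⟨P, hPn.2⟩| := hsub (a := ⟨P, hPn.2⟩) hP
    have h4 : (0 : ℝ) < 4 ^ n := by positivity
    nlinarith

end LocalHeightUniqueness

/-! ### The rigidified isomorphism `L^{⊗ 4} ≅ [2]^* L` -/

section Forms

open MvPolynomial

variable {F : Type*} [Field F]

/-- The monomial `a Xⁱ Yʲ Zᵏ`. -/
def monom (a : F) (i j k : ℕ) : MvPolynomial (Fin 3) F := C a * X 0 ^ i * X 1 ^ j * X 2 ^ k

@[simp]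
theorem eval_monom (a : F) (i j k : ℕ) (v : Fin 3 → F) :
    eval v (monom a i j k) = a * v 0 ^ i * v 1 ^ j * v 2 ^ k := by
  simp [monom]

theorem isHomogeneous_monom (a : F) (i j k : ℕ) : (monom a i j k).IsHomogeneous (i + j + k) := by
  have h := (((isHomogeneous_C (Fin 3) a).mul ((isHomogeneous_X F (0 : Fin 3)).pow i)).mul
    ((isHomogeneous_X F (1 : Fin 3)).pow j)).mul ((isHomogeneous_X F (2 : Fin 3)).pow k)
  simpa [monom] using h

theorem eval_smul_of_isHomogeneous {p : MvPolynomial (Fin 3) F} {d : ℕ} (hp : p.IsHomogeneous d)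
    (c : F) (v : Fin 3 → F) : eval (c • v) p = c ^ d * eval v p := by
  rw [eval_eq, eval_eq, Finset.mul_sum]
  refine Finset.sum_congr rfl fun s hs => ?_
  simp only [Pi.smul_apply, smul_eq_mul, mul_pow, Finset.prod_mul_distrib]
  rw [hp.degree_eq_sum_deg_support hs, ← Finset.prod_pow_eq_pow_sum]
  ring

variable (W : WeierstrassCurve.Affine F)

/-- The form of degree `1` that is `psi` on the affine chart. -/
def psiForm : MvPolynomial (Fin 3) F := monom 2 0 1 0 + monom W.a₁ 1 0 0 + monom W.a₃ 0 0 1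

/-- The form of degree `4` that is `phi` on the affine chart. -/
def phiForm : MvPolynomial (Fin 3) F :=
  monom 1 4 0 0 + monom (-W.b₄) 2 0 2 + monom (-2 * W.b₆) 1 0 3 + monom (-W.b₈) 0 0 4

/-- The form of degree `4` that is `omega` on the affine chart. -/
def omegaForm : MvPolynomial (Fin 3) F :=
  monom 1 0 4 0 + monom (omegaCoeff W 0) 1 3 0 + monom (omegaCoeff W 1) 0 3 1
    + monom (omegaCoeff W 2) 1 2 1 + monom (omegaCoeff W 3) 2 1 1 + monom (omegaCoeff W 4) 0 2 2
    + monom (omegaCoeff W 5) 1 1 2 + monom (omegaCoeff W 6) 2 0 2 + monom (omegaCoeff W 7) 0 1 3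
    + monom (omegaCoeff W 8) 1 0 3 + monom (omegaCoeff W 9) 0 0 4

/-- The quadratic form `D` for which the Weierstrass equation reads `X ^ 3 = Z * D`. It does not
vanish at `∞`, so that `Z / X = X ^ 2 / D` is regular there. -/
def cubicCofactor : MvPolynomial (Fin 3) F :=
  monom 1 0 2 0 + monom W.a₁ 1 1 0 + monom W.a₃ 0 1 1 + monom (-W.a₂) 2 0 0 + monom (-W.a₄) 1 0 1
    + monom (-W.a₆) 0 0 2

/-- The form `D ^ 4 * (phi / x ^ 4)`, where `1 / x` is expressed by `X ^ 2 / D`. -/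
def phiFormAtInfinity : MvPolynomial (Fin 3) F :=
  cubicCofactor W ^ 4 + monom (-W.b₄) 4 0 0 * cubicCofactor W ^ 2
    + monom (-2 * W.b₆) 6 0 0 * cubicCofactor W + monom (-W.b₈) 8 0 0

/-- Numerator, near `∞`, of the isomorphism in terms of the generators over `U`. -/
def numAtInfinity : MvPolynomial (Fin 3) F := phiFormAtInfinity W * X 1 ^ 4

/-- Denominator, near `∞`, of the isomorphism in terms of the generators over `U`. -/
def denAtInfinity : MvPolynomial (Fin 3) F := cubicCofactor W ^ 4 * omegaForm W

theorem isHomogeneous_psiForm : (psiForm W).IsHomogeneous 1 :=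
  ((isHomogeneous_monom _ 0 1 0).add (isHomogeneous_monom _ 1 0 0)).add
    (isHomogeneous_monom _ 0 0 1)

theorem isHomogeneous_phiForm : (phiForm W).IsHomogeneous 4 :=
  (((isHomogeneous_monom _ 4 0 0).add (isHomogeneous_monom _ 2 0 2)).add
    (isHomogeneous_monom _ 1 0 3)).add (isHomogeneous_monom _ 0 0 4)

theorem isHomogeneous_omegaForm : (omegaForm W).IsHomogeneous 4 :=
  ((((((((((isHomogeneous_monom _ 0 4 0).add (isHomogeneous_monom _ 1 3 0)).add
    (isHomogeneous_monom _ 0 3 1)).add (isHomogeneous_monom _ 1 2 1)).add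
    (isHomogeneous_monom _ 2 1 1)).add (isHomogeneous_monom _ 0 2 2)).add
    (isHomogeneous_monom _ 1 1 2)).add (isHomogeneous_monom _ 2 0 2)).add
    (isHomogeneous_monom _ 0 1 3)).add (isHomogeneous_monom _ 1 0 3)).add
    (isHomogeneous_monom _ 0 0 4)

theorem isHomogeneous_cubicCofactor : (cubicCofactor W).IsHomogeneous 2 :=
  (((((isHomogeneous_monom _ 0 2 0).add (isHomogeneous_monom _ 1 1 0)).add
    (isHomogeneous_monom _ 0 1 1)).add (isHomogeneous_monom _ 2 0 0)).add
    (isHomogeneous_monom _ 1 0 1)).add (isHomogeneous_monom _ 0 0 2)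

theorem isHomogeneous_numAtInfinity : (numAtInfinity W).IsHomogeneous 12 :=
  (((((isHomogeneous_cubicCofactor W).pow 4).add
    ((isHomogeneous_monom _ 4 0 0).mul ((isHomogeneous_cubicCofactor W).pow 2))).add
    ((isHomogeneous_monom _ 6 0 0).mul (isHomogeneous_cubicCofactor W))).add
    (isHomogeneous_monom _ 8 0 0)).mul (isHomogeneous_X_pow 1 4)

theorem isHomogeneous_denAtInfinity : (denAtInfinity W).IsHomogeneous 12 :=
  ((isHomogeneous_cubicCofactor W).pow 4).mul (isHomogeneous_omegaForm W)

variable {W} {x y : F}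

theorem eval_psiForm : eval ![x, y, 1] (psiForm W) = psi W x y := by
  simp [psiForm, psi]

theorem eval_phiForm : eval ![x, y, 1] (phiForm W) = phi W x := by
  simp [phiForm, phi]; ring

theorem eval_omegaForm : eval ![x, y, 1] (omegaForm W) = omega W x y := by
  simp [omegaForm, omega]

theorem eval_cubicCofactor (h : W.Equation x y) :
    eval ![x, y, 1] (cubicCofactor W) = x ^ 3 := by
  rw [WeierstrassCurve.Affine.equation_iff] at h
  simp [cubicCofactor]
  linear_combination h

theorem eval_numAtInfinity (h : W.Equation x y) :
    eval ![x, y, 1] (numAtInfinity W) = x ^ 8 * phi W x * y ^ 4 := by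
  simp only [numAtInfinity, phiFormAtInfinity, map_mul, map_add, map_pow, eval_cubicCofactor h,
    eval_monom, eval_X, phi, Matrix.cons_val]
  ring

theorem eval_denAtInfinity (h : W.Equation x y) :
    eval ![x, y, 1] (denAtInfinity W) = x ^ 12 * omega W x y := by
  simp only [denAtInfinity, map_mul, map_pow, eval_cubicCofactor h, eval_omegaForm]
  ring

theorem eval_zero_numAtInfinity : eval ![0, 1, 0] (numAtInfinity W) = 1 := by
  simp [numAtInfinity, phiFormAtInfinity, cubicCofactor]

theorem eval_zero_denAtInfinity : eval ![0, 1, 0] (denAtInfinity W) = 1 := by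
  simp [denAtInfinity, cubicCofactor, omegaForm]

end Forms

section RigidifiedIso

open WeierstrassCurve.Affine (Point)

variable {F : Type*} [Field F]

open Classical in
/-- The isomorphism `L^{⊗ 4} ≅ [2]^* L`, in the chosen basis of the fibres: it is `-1 / ψ₂` away
from the points of order two. At those points the basis of the target fibre is the value of `t⁻¹`
instead of `1`, and the coefficient is `-1 / N` for the numerator `N` of the slope of the tangent
line. -/
def dupIso (W : WeierstrassCurve.Affine F) : W.Point → F
  | .zero => 1
  | .some x y _ => if psi W x y = 0 then -(tangentNum W x y)⁻¹ else -(psi W x y)⁻¹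

variable {W : WeierstrassCurve.Affine F}

theorem dupIso_ne_zero (Q : W.Point) : dupIso W Q ≠ 0 := by
  cases Q with
  | zero => exact one_ne_zero
  | some x y h =>
    rw [dupIso]
    split_ifs with hψ
    · exact neg_ne_zero.2 (inv_ne_zero (tangentNum_ne_zero h hψ))
    · exact neg_ne_zero.2 (inv_ne_zero hψ)

variable {x y : F}

open Classical in
theorem two_nsmul_mem_domain_U_iff (h : W.Nonsingular x y) :
    (2 : ℕ) • Point.some x y h ∈ Chart.U.domain ↔ phi W x ≠ 0 ∧ omega W x y ≠ 0 := by
  by_cases hψ : psi W x y = 0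
  · have hN := tangentNum_ne_zero h hψ
    rw [two_nsmul_of_psi_eq_zero h hψ, phi_of_psi_eq_zero h.1 hψ, omega_of_psi_eq_zero h.1 hψ]
    exact iff_of_true (Or.inl rfl) ⟨pow_ne_zero _ hN, by simpa using hN⟩
  · obtain ⟨h', e⟩ := two_nsmul_of_psi_ne_zero h hψ
    rw [e]
    change _ = _ ∨ (_ ≠ _ ∧ _ ≠ _) ↔ _
    simp [xCoord, yCoord, hψ]

open Classical in
/-- In terms of the generators over `Y` and over `U`, the isomorphism is regular at the points of
order two. -/
theorem dupIso_div_generator_U (h : W.Nonsingular x y)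
    (hU : (2 : ℕ) • Point.some x y h ∈ Chart.U.domain) :
    dupIso W (.some x y h) / Chart.U.generator ((2 : ℕ) • Point.some x y h) =
      phi W x / omega W x y := by
  obtain ⟨hφ, hω⟩ := (two_nsmul_mem_domain_U_iff h).1 hU
  by_cases hψ : psi W x y = 0
  · have hN := tangentNum_ne_zero h hψ
    rw [two_nsmul_of_psi_eq_zero h hψ, phi_of_psi_eq_zero h.1 hψ, omega_of_psi_eq_zero h.1 hψ]
    simp only [dupIso, Chart.generator, if_pos hψ, if_true]
    field_simp
  · obtain ⟨h', e⟩ := two_nsmul_of_psi_ne_zero h hψ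
    rw [e]
    simp only [dupIso, if_neg hψ, Chart.generator, tCoord, xCoord, yCoord]
    rw [if_neg (WeierstrassCurve.Affine.Point.some_ne_zero h')]
    field_simp

open Classical in
theorem dupIso_mul_generator_U (h : W.Nonsingular x y)
    (h1 : Point.some x y h ∈ Chart.U.domain)
    (h2 : (2 : ℕ) • Point.some x y h ∈ Chart.U.domain) :
    x ≠ 0 ∧ y ≠ 0 ∧ omega W x y ≠ 0 ∧
      dupIso W (.some x y h) * Chart.U.generator (Point.some x y h) ^ 2 ^ 2 /
        Chart.U.generator ((2 : ℕ) • Point.some x y h) =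
        phi W x * y ^ 4 / (omega W x y * x ^ 4) := by
  obtain ⟨hx, hy⟩ := h1.resolve_left (WeierstrassCurve.Affine.Point.some_ne_zero h)
  simp only [xCoord, yCoord] at hx hy
  have hω := ((two_nsmul_mem_domain_U_iff h).1 h2).2
  refine ⟨hx, hy, hω, ?_⟩
  have hgen : Chart.U.generator (Point.some x y h) ^ 2 ^ 2 = (y / x) ^ 4 := by
    rw [Chart.generator, if_neg (WeierstrassCurve.Affine.Point.some_ne_zero h), tCoord, xCoord,
      yCoord, neg_div, inv_neg, inv_div]
    ring
  rw [mul_div_right_comm, dupIso_div_generator_U h h2, hgen]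
  field_simp

open Classical in
theorem isRigidifiedIso_dupIso : IsRigidifiedIso 2 (dupIso W) where
  ne_zero := dupIso_ne_zero
  rigid := rfl
  regular := by
    rintro (_ | _) (_ | _) Q₀ ⟨h₀, h₀'⟩
    · refine ⟨1, monom (-1) 0 0 1, psiForm W, isHomogeneous_monom _ 0 0 1,
        isHomogeneous_psiForm W, ?_, fun Q hQ hB => ?_⟩
      · cases Q₀ with
        | zero => exact absurd rfl h₀
        | some x y h =>
          rw [coords, eval_psiForm]
          exact fun hψ => h₀' (two_nsmul_of_psi_eq_zero h hψ)
      · cases Q with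
        | zero => exact absurd rfl hQ.1
        | some x y h =>
          rw [coords, eval_psiForm] at hB ⊢
          simp [Chart.generator, dupIso, if_neg hB, neg_div]
    · refine ⟨4, phiForm W, omegaForm W, isHomogeneous_phiForm W, isHomogeneous_omegaForm W,
        ?_, fun Q hQ hB => ?_⟩
      · cases Q₀ with
        | zero => exact absurd rfl h₀
        | some x y h =>
          rw [coords, eval_omegaForm]
          exact ((two_nsmul_mem_domain_U_iff h).1 h₀').2
      · cases Q with
        | zero => exact absurd rfl hQ.1
        | some x y h =>
          rw [coords, eval_omegaForm, eval_phiForm, ← dupIso_div_generator_U h hQ.2]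
          simp [Chart.generator]
    · refine ⟨5, monom (-1) 0 4 1, psiForm W * monom 1 4 0 0, isHomogeneous_monom _ 0 4 1,
        (isHomogeneous_psiForm W).mul (isHomogeneous_monom _ 4 0 0), ?_, fun Q hQ hB => ?_⟩
      · cases Q₀ with
        | zero => exact absurd (nsmul_zero 2) h₀'
        | some x y h =>
          obtain ⟨hx, hy⟩ := h₀.resolve_left (WeierstrassCurve.Affine.Point.some_ne_zero h)
          have hψ : psi W x y ≠ 0 := fun hψ => h₀' (two_nsmul_of_psi_eq_zero h hψ)
          rw [coords, map_mul, eval_psiForm]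
          simpa [hψ, xCoord] using hx
      · cases Q with
        | zero => exact absurd (nsmul_zero 2) hQ.2
        | some x y h =>
          obtain ⟨hx, hy⟩ := hQ.1.resolve_left (WeierstrassCurve.Affine.Point.some_ne_zero h)
          simp only [xCoord, yCoord] at hx hy
          have hψ : psi W x y ≠ 0 := fun hψ => hQ.2 (two_nsmul_of_psi_eq_zero h hψ)
          rw [coords, map_mul, eval_psiForm]
          simp only [Chart.generator, dupIso, if_neg hψ, tCoord, xCoord, yCoord,
            if_neg (WeierstrassCurve.Affine.Point.some_ne_zero h), eval_monom]
          simp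
          field_simp
    · cases Q₀ with
      | zero =>
        refine ⟨12, numAtInfinity W, denAtInfinity W, isHomogeneous_numAtInfinity W,
          isHomogeneous_denAtInfinity W, ?_, fun Q hQ hB => ?_⟩
        · rw [coords, eval_zero_denAtInfinity]
          exact one_ne_zero
        · cases Q with
          | zero =>
            rw [coords, eval_zero_numAtInfinity, eval_zero_denAtInfinity]
            change dupIso W .zero * Chart.U.generator (0 : W.Point) ^ 2 ^ 2 /
              Chart.U.generator ((2 : ℕ) • (0 : W.Point)) = _
            rw [nsmul_zero]
            simp [dupIso, Chart.generator]
          | some x y h =>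
            obtain ⟨hx, hy, hω, e⟩ := dupIso_mul_generator_U h hQ.1 hQ.2
            refine e.trans ?_
            rw [coords, eval_numAtInfinity h.1, eval_denAtInfinity h.1]
            field_simp
      | some x y h =>
        refine ⟨8, phiForm W * monom 1 0 4 0, omegaForm W * monom 1 4 0 0,
          (isHomogeneous_phiForm W).mul (isHomogeneous_monom _ 0 4 0),
          (isHomogeneous_omegaForm W).mul (isHomogeneous_monom _ 4 0 0), ?_, fun Q hQ hB => ?_⟩
        · obtain ⟨hx, hy, hω, -⟩ := dupIso_mul_generator_U h h₀ h₀'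
          rw [coords, map_mul, eval_omegaForm]
          simp [hω, hx]
        · cases Q with
          | zero => simp [coords] at hB
          | some x y h =>
            obtain ⟨hx, hy, hω, e⟩ := dupIso_mul_generator_U h hQ.1 hQ.2
            refine e.trans ?_
            rw [coords, map_mul, map_mul, eval_omegaForm, eval_phiForm]
            simp

end RigidifiedIso

/-! ### Uniqueness of the rigidified isomorphism -/

section RigidifiedIsoUniqueness

open WeierstrassCurve.Affine (Point)

/-- Restriction of a form to the affine chart `Z = 1`. -/
def dehomogenize {F : Type*} [Field F] :
    MvPolynomial (Fin 3) F →ₐ[F] MvPolynomial (Fin 2) F :=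
  MvPolynomial.aeval ![MvPolynomial.X 0, MvPolynomial.X 1, 1]

theorem eval_dehomogenize {F : Type*} [Field F] (x y : F) (A : MvPolynomial (Fin 3) F) :
    MvPolynomial.eval ![x, y] (dehomogenize A) = MvPolynomial.eval ![x, y, 1] A := by
  induction A using MvPolynomial.induction_on with
  | C a => simp [dehomogenize]
  | add p q hp hq => rw [map_add, map_add, map_add, hp, hq]
  | mul_X p i hp =>
    rw [map_mul, map_mul, map_mul, hp]
    congr 1
    fin_cases i <;> simp [dehomogenize]

variable {K : Type*} [Field K] {W : WeierstrassCurve.Affine K}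

theorem exists_equation [IsAlgClosed K] (W : WeierstrassCurve.Affine K) (x : K) :
    ∃ y, W.Equation x y := by
  obtain ⟨y, hy⟩ := IsAlgClosed.exists_root
    (Polynomial.C 1 * Polynomial.X ^ 2 + Polynomial.C (W.a₁ * x + W.a₃) * Polynomial.X +
      Polynomial.C (-(x ^ 3 + W.a₂ * x ^ 2 + W.a₄ * x + W.a₆)))
    (by rw [Polynomial.degree_quadratic one_ne_zero]; decide)
  refine ⟨y, (WeierstrassCurve.Affine.equation_iff ..).2 ?_⟩
  simp at hy
  linear_combination hy

open Classical in
/-- Two rigidified isomorphisms differ on `Y` by a regular function; by the Nullstellensatz the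
ideal of its denominators is the unit ideal, so it is given by one polynomial. -/
theorem IsRigidifiedIso.exists_polynomial [IsAlgClosed K] [W.IsElliptic] {b : W.Point → K}
    (hb : IsRigidifiedIso 2 b) : ∃ P : MvPolynomial (Fin 2) K, ∀ (x y : K) (h : W.Nonsingular x y),
      b (.some x y h) = dupIso W (.some x y h) * MvPolynomial.eval ![x, y] P := by
  let J : Ideal (MvPolynomial (Fin 2) K) :=
    { carrier := {B | ∃ A : MvPolynomial (Fin 2) K, ∀ (x y : K) (h : W.Nonsingular x y),
        b (.some x y h) * MvPolynomial.eval ![x, y] B =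
          dupIso W (.some x y h) * MvPolynomial.eval ![x, y] A}
      zero_mem' := ⟨0, fun x y h => by simp⟩
      add_mem' := by
        rintro B B' ⟨A, hA⟩ ⟨A', hA'⟩
        refine ⟨A + A', fun x y h => ?_⟩
        rw [map_add, map_add, mul_add, mul_add, hA, hA']
      smul_mem' := by
        rintro p B ⟨A, hA⟩
        refine ⟨p * A, fun x y h => ?_⟩
        rw [smul_eq_mul, map_mul, map_mul, mul_left_comm, hA, mul_left_comm] }
  by_cases hJ : J = ⊤
  · obtain ⟨P, hP⟩ : (1 : MvPolynomial (Fin 2) K) ∈ J := hJ ▸ Submodule.mem_top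
    exact ⟨P, fun x y h => by simpa using hP x y h⟩
  exfalso
  obtain ⟨M, hM, hJM⟩ := Ideal.exists_le_maximal J hJ
  obtain ⟨z, hz⟩ := MvPolynomial.isMaximal_iff_eq_vanishingIdeal_singleton.1 hM
  have hvan : ∀ B ∈ J, MvPolynomial.eval ![z 0, z 1] B = 0 := by
    intro B hB
    have h1 := hJM hB
    rw [hz, MvPolynomial.mem_vanishingIdeal_singleton_iff] at h1
    have h2 : ![z 0, z 1] = z := by ext i; fin_cases i <;> rfl
    rwa [h2, ← MvPolynomial.coe_aeval_eq_eval]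
  generalize z 0 = x₀, z 1 = y₀ at hvan
  -- The Weierstrass polynomial belongs to `J`, so the common zero is a point of the curve.
  have hE : W.Equation x₀ y₀ := by
    have h1 := hvan (dehomogenize (cubicCofactor W) - MvPolynomial.X 0 ^ 3) ⟨0, fun x y h => by
      rw [map_sub, eval_dehomogenize, eval_cubicCofactor h.1]; simp⟩
    rw [map_sub, eval_dehomogenize] at h1
    simp [cubicCofactor] at h1
    rw [WeierstrassCurve.Affine.equation_iff]
    linear_combination h1
  have h₀ : W.Nonsingular x₀ y₀ := WeierstrassCurve.Affine.equation_iff_nonsingular.1 hE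
  by_cases hψ₀ : psi W x₀ y₀ = 0
  · have hU₀ : (2 : ℕ) • Point.some x₀ y₀ h₀ ∈ Chart.U.domain := by
      rw [two_nsmul_of_psi_eq_zero h₀ hψ₀]; exact Or.inl rfl
    obtain ⟨hφ₀, hω₀⟩ := (two_nsmul_mem_domain_U_iff h₀).1 hU₀
    obtain ⟨d, A, B, -, -, hB, H⟩ := hb.regular .Y .U (.some x₀ y₀ h₀)
      ⟨WeierstrassCurve.Affine.Point.some_ne_zero h₀, hU₀⟩
    rw [coords] at hB
    -- The square of `B` makes the identity hold also where `B` vanishes.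
    have h1 := hvan (dehomogenize (B ^ 2 * phiForm W ^ 2 * omegaForm W))
      ⟨dehomogenize (A * B * phiForm W * omegaForm W ^ 2), fun x y h => by
        rw [eval_dehomogenize, eval_dehomogenize]
        simp only [map_mul, map_pow, eval_phiForm, eval_omegaForm]
        by_cases hU : (2 : ℕ) • Point.some x y h ∈ Chart.U.domain
        · obtain ⟨hφ, hω⟩ := (two_nsmul_mem_domain_U_iff h).1 hU
          by_cases hBv : MvPolynomial.eval ![x, y, 1] B = 0
          · simp [hBv]
          have e1 := H (.some x y h) ⟨WeierstrassCurve.Affine.Point.some_ne_zero h, hU⟩ hBv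
          have e2 := dupIso_div_generator_U h hU
          have hg : Chart.U.generator ((2 : ℕ) • Point.some x y h) ≠ 0 := by
            intro hg
            rw [hg, div_zero] at e2
            exact div_ne_zero hφ hω e2.symm
          simp only [Chart.generator.eq_1, one_pow, mul_one, coords] at e1
          rw [div_eq_div_iff hg hBv] at e1
          rw [div_eq_div_iff hg hω] at e2
          refine mul_left_cancel₀ hg ?_
          linear_combination (MvPolynomial.eval ![x, y, 1] B * phi W x ^ 2 * omega W x y *
              Chart.U.generator ((2 : ℕ) • Point.some x y h)) * e1 -
            (MvPolynomial.eval ![x, y, 1] A * MvPolynomial.eval ![x, y, 1] B * phi W x *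
              omega W x y * Chart.U.generator ((2 : ℕ) • Point.some x y h)) * e2
        · rw [two_nsmul_mem_domain_U_iff h, not_and_or, not_not, not_not] at hU
          rcases hU with hφ | hω
          · simp [hφ]
          · simp [hω]⟩
    rw [eval_dehomogenize] at h1
    simp only [map_mul, map_pow, eval_phiForm, eval_omegaForm] at h1
    exact mul_ne_zero (mul_ne_zero (pow_ne_zero _ hB) (pow_ne_zero _ hφ₀)) hω₀ h1
  · have hY₀ : (2 : ℕ) • Point.some x₀ y₀ h₀ ≠ 0 :=
      fun h => hψ₀ ((two_nsmul_some_eq_zero_iff h₀).1 h)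
    obtain ⟨d, A, B, -, -, hB, H⟩ := hb.regular .Y .Y (.some x₀ y₀ h₀)
      ⟨WeierstrassCurve.Affine.Point.some_ne_zero h₀, hY₀⟩
    rw [coords] at hB
    have h1 := hvan (dehomogenize (B ^ 2 * psiForm W))
      ⟨dehomogenize (-(A * B * psiForm W ^ 2)), fun x y h => by
        rw [eval_dehomogenize, eval_dehomogenize]
        simp only [map_mul, map_pow, map_neg, eval_psiForm]
        by_cases hψ : psi W x y = 0
        · simp [hψ]
        by_cases hBv : MvPolynomial.eval ![x, y, 1] B = 0
        · simp [hBv]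
        have e1 := H (.some x y h) ⟨WeierstrassCurve.Affine.Point.some_ne_zero h,
          fun h0 => hψ ((two_nsmul_some_eq_zero_iff h).1 h0)⟩ hBv
        simp only [Chart.generator.eq_1, one_pow, mul_one, div_one, coords] at e1
        rw [e1, dupIso, if_neg hψ]
        field_simp⟩
    rw [eval_dehomogenize] at h1
    simp only [map_mul, map_pow, eval_psiForm] at h1
    exact mul_ne_zero (pow_ne_zero _ hB) hψ₀ h1

/-- Every polynomial function on the curve has the form `p(x) + q(x) y`. -/
theorem exists_eval_eq_add_mul (W : WeierstrassCurve.Affine K) (P : MvPolynomial (Fin 2) K) :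
    ∃ p q : Polynomial K, ∀ x y, W.Equation x y →
      MvPolynomial.eval ![x, y] P = p.eval x + q.eval x * y := by
  induction P using MvPolynomial.induction_on with
  | C a => exact ⟨Polynomial.C a, 0, fun x y _ => by simp⟩
  | add P P' h h' =>
    obtain ⟨p, q, H⟩ := h
    obtain ⟨p', q', H'⟩ := h'
    refine ⟨p + p', q + q', fun x y h => ?_⟩
    rw [map_add, H x y h, H' x y h, Polynomial.eval_add, Polynomial.eval_add]
    ring
  | mul_X P i h =>
    obtain ⟨p, q, H⟩ := h
    fin_cases i
    · refine ⟨p * Polynomial.X, q * Polynomial.X, fun x y h => ?_⟩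
      rw [map_mul, H x y h]
      simp
      ring
    · refine ⟨q * (Polynomial.X ^ 3 + Polynomial.C W.a₂ * Polynomial.X ^ 2 +
          Polynomial.C W.a₄ * Polynomial.X + Polynomial.C W.a₆),
        p - q * (Polynomial.C W.a₁ * Polynomial.X + Polynomial.C W.a₃), fun x y h => ?_⟩
      rw [map_mul, H x y h]
      rw [WeierstrassCurve.Affine.equation_iff] at h
      simp
      linear_combination (Polynomial.eval x q) * h

/-- A polynomial function without zeros on `Y` is constant, as its norm to `K[x]` is. -/
theorem eq_const_of_ne_zero [IsAlgClosed K] (W : WeierstrassCurve.Affine K) {p q : Polynomial K}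
    (h0 : ∀ x y, W.Equation x y → p.eval x + q.eval x * y ≠ 0) :
    ∃ c : K, ∀ x y, p.eval x + q.eval x * y = c := by
  have hdeg := WeierstrassCurve.Affine.CoordinateRing.degree_norm_smul_basis (W' := W) p q
  rw [WeierstrassCurve.Affine.CoordinateRing.norm_smul_basis] at hdeg
  have hN : (p ^ 2 - p * q * (Polynomial.C W.a₁ * Polynomial.X + Polynomial.C W.a₃) -
      q ^ 2 * (Polynomial.X ^ 3 + Polynomial.C W.a₂ * Polynomial.X ^ 2 +
        Polynomial.C W.a₄ * Polynomial.X + Polynomial.C W.a₆)).degree = 0 := by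
    by_contra hne
    obtain ⟨x, hx⟩ := IsAlgClosed.exists_root _ hne
    obtain ⟨y, hy⟩ := exists_equation W x
    refine mul_ne_zero (h0 x y hy)
      (h0 x _ ((WeierstrassCurve.Affine.equation_neg x y).2 hy)) ?_
    rw [WeierstrassCurve.Affine.equation_iff] at hy
    simp at hx
    rw [WeierstrassCurve.Affine.negY]
    linear_combination hx - Polynomial.eval x q ^ 2 * hy
  rw [hN] at hdeg
  have hq : q = 0 := by
    by_contra hq
    have h1 := le_max_right (2 • p.degree) (2 • q.degree + 3)
    rw [← hdeg, Polynomial.degree_eq_natDegree hq, nsmul_eq_mul] at h1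
    have h2 : (2 * q.natDegree + 3 : ℕ) ≤ (0 : ℕ) := by exact_mod_cast h1
    omega
  have hp : p.degree ≤ 0 := by
    by_cases hp0 : p = 0
    · simp [hp0]
    have h1 := le_max_left (2 • p.degree) (2 • q.degree + 3)
    rw [← hdeg, Polynomial.degree_eq_natDegree hp0, nsmul_eq_mul] at h1
    have h2 : (2 * p.natDegree : ℕ) ≤ (0 : ℕ) := by exact_mod_cast h1
    exact Polynomial.natDegree_eq_zero_iff_degree_le_zero.1 (by omega)
  refine ⟨p.coeff 0, fun x y => ?_⟩
  rw [Polynomial.eq_C_of_degree_le_zero hp]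
  simp [hq]

end RigidifiedIsoUniqueness

section RigidifiedIsoNormalisation

open WeierstrassCurve.Affine (Point)

variable {K : Type*} [NontriviallyNormedField K] [IsAlgClosed K] {W : WeierstrassCurve.Affine K}
  [W.IsElliptic]

open Classical in
/-- The rigidification determines the isomorphism: the constant by which it differs from `dupIso`
on `Y` is seen to be `1` by letting points tend to `∞`. -/
theorem IsRigidifiedIso.eq_dupIso {b : W.Point → K} (hb : IsRigidifiedIso 2 b) :
    b = dupIso W := by
  obtain ⟨P, hP⟩ := hb.exists_polynomial
  obtain ⟨p, q, hpq⟩ := exists_eval_eq_add_mul W P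
  obtain ⟨c, hc⟩ := eq_const_of_ne_zero W (p := p) (q := q) fun x y h h0 => by
    have hns := WeierstrassCurve.Affine.equation_iff_nonsingular.1 h
    refine hb.ne_zero (.some x y hns) ?_
    rw [hP, hpq x y h, h0, mul_zero]
  have hbc : ∀ (x y : K) (h : W.Nonsingular x y),
      b (.some x y h) = dupIso W (.some x y h) * c := fun x y h => by
    rw [hP, hpq x y h.1, hc]
  obtain ⟨d, A, B, hA, hB, hB0, H⟩ := hb.regular .U .U 0
    ⟨Or.inl rfl, Or.inl (nsmul_zero 2)⟩
  have hcoords : coords (0 : W.Point) = ![0, 1, 0] := rfl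
  have h0 : MvPolynomial.eval ![0, 1, 0] A = MvPolynomial.eval ![0, 1, 0] B := by
    have := H 0 ⟨Or.inl rfl, Or.inl (nsmul_zero 2)⟩ hB0
    rw [hcoords] at hB0 this
    simp only [nsmul_zero, Chart.generator.eq_2, if_true, one_pow, mul_one, div_one,
      hb.rigid] at this
    exact ((div_eq_one_iff_eq hB0).1 this.symm)
  rw [hcoords] at hB0
  set G : MvPolynomial (Fin 3) K :=
    MvPolynomial.C c * (numAtInfinity W * B) - A * denAtInfinity W with hG
  have hGhom : G.IsHomogeneous (12 + d) := by
    refine (((isHomogeneous_numAtInfinity W).mul hB).C_mul c).sub ?_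
    rw [add_comm]
    exact hA.mul (isHomogeneous_denAtInfinity W)
  have hG0 : MvPolynomial.eval ![0, 1, 0] G = 0 := by
    by_contra hne
    have hcont : ∀ p : MvPolynomial (Fin 3) K,
        Continuous fun v : Fin 3 → K => MvPolynomial.eval v p := MvPolynomial.continuous_eval
    have hmem : {v : Fin 3 → K | MvPolynomial.eval v
        (G * B * numAtInfinity W * denAtInfinity W) ≠ 0} ∈ 𝓝 (coords (0 : W.Point)) := by
      refine (isOpen_ne.preimage (hcont _)).mem_nhds ?_
      rw [hcoords]
      change MvPolynomial.eval _ _ ≠ 0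
      rw [map_mul, map_mul, map_mul, eval_zero_numAtInfinity, eval_zero_denAtInfinity]
      simpa using ⟨hne, hB0⟩
    obtain ⟨R, hR⟩ := exists_coords_mem_of_lt_norm_x W hmem
    obtain ⟨x, hx⟩ := NormedField.exists_lt_norm K R
    obtain ⟨y, hxy⟩ := exists_equation W x
    have h := WeierstrassCurve.Affine.equation_iff_nonsingular.1 hxy
    obtain ⟨hy0, hv⟩ := hR x y hxy hx
    have hsm : ![x / y, 1, 1 / y] = y⁻¹ • ![x, y, 1] := by
      ext i
      fin_cases i <;> simp [hy0, div_eq_inv_mul]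
    have hhom := (((hGhom.mul hB).mul (isHomogeneous_numAtInfinity W)).mul
      (isHomogeneous_denAtInfinity W))
    rw [Set.mem_ofPred_eq, hsm, eval_smul_of_isHomogeneous hhom] at hv
    have hv' := right_ne_zero_of_mul hv
    rw [map_mul, map_mul, map_mul, eval_numAtInfinity hxy, eval_denAtInfinity hxy] at hv'
    simp only [ne_eq, mul_eq_zero, not_or, pow_eq_zero_iff, OfNat.ofNat_ne_zero,
      not_false_eq_true] at hv'
    obtain ⟨⟨⟨hGv, hBv⟩, ⟨hx0, hφ⟩, -⟩, -, hω⟩ := hv'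
    have hU : Point.some x y h ∈ Chart.U.domain := Or.inr ⟨hx0, hy0⟩
    have hU2 := (two_nsmul_mem_domain_U_iff h).2 ⟨hφ, hω⟩
    have e1 := H (.some x y h) ⟨hU, hU2⟩ hBv
    obtain ⟨-, -, -, e2⟩ := dupIso_mul_generator_U h hU hU2
    simp only [hbc] at e1
    rw [mul_right_comm, mul_div_right_comm, e2, coords] at e1
    refine hGv ?_
    rw [hG, map_sub, map_mul, map_mul, map_mul, eval_numAtInfinity hxy, eval_denAtInfinity hxy,
      MvPolynomial.eval_C]
    field_simp at e1
    linear_combination x ^ 8 * e1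
  rw [hG, map_sub, map_mul, map_mul, map_mul, eval_zero_numAtInfinity, eval_zero_denAtInfinity,
    MvPolynomial.eval_C, h0, one_mul, mul_one] at hG0
  have hc1 : c = 1 := mul_right_cancel₀ hB0 (by linear_combination hG0)
  funext Q
  cases Q with
  | zero => exact hb.rigid
  | some x y h => rw [hbc, hc1, mul_one]

end RigidifiedIsoNormalisation

/-! ### Existence and uniqueness of the canonical metric -/

section CanonicalMetricExistence

variable {K : Type*} [NormedField K] (W : WeierstrassCurve.Affine K)

/-- The local height over `K`, extended by `0` to `∞`; it is minus the logarithm of the norm of the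
chosen basis of the fibres of `L`. -/
def pointHeight : W.Point → ℝ
  | .zero => 0
  | .some x _ _ => 1 / 2 * homHeight W (x, 1)

/-- The canonical metric, given by the local height. -/
def canonicalMetric : Metric W where
  norm v := ‖v.2‖ * Real.exp (-pointHeight W v.1)
  pos Q z hz := mul_pos (norm_pos_iff.2 hz) (Real.exp_pos _)
  smul Q c z := by simp only [norm_mul, mul_assoc]

variable [W.IsElliptic]

theorem exists_abs_two_mul_pointHeight_sub_le : ∃ B : ℝ, ∀ (x y : K) (h : W.Nonsingular x y),
    |2 * pointHeight W (.some x y h) - Real.log (max ‖x‖ 1)| ≤ B := by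
  obtain ⟨B, hB⟩ := exists_abs_homHeight_sub_log_norm_le W
  refine ⟨B, fun x y h => ?_⟩
  have h1 := hB _ (pair_one_ne_zero x)
  have hn : ‖((x, 1) : K × K)‖ = max ‖x‖ 1 := by simp [Prod.norm_def]
  rw [hn] at h1
  rw [pointHeight, ← mul_assoc]
  norm_num
  exact h1

theorem isLocallyBounded_canonicalMetric : (canonicalMetric W).IsLocallyBounded := by
  obtain ⟨B, hB⟩ := exists_abs_two_mul_pointHeight_sub_le W
  rintro (_ | _) C
  · refine ⟨1 / 2 * (B + Real.log (max C 1)), fun Q hQ => ?_⟩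
    cases Q with
    | zero => exact absurd rfl hQ.1
    | some x y h =>
      have h1 := hB x y h
      have h2 : 0 ≤ Real.log (max ‖x‖ 1) := Real.log_nonneg (le_max_right _ _)
      have h3 : Real.log (max ‖x‖ 1) ≤ Real.log (max C 1) :=
        Real.log_le_log (by positivity) (max_le_max_right _ hQ.2.1)
      simp only [canonicalMetric, Chart.generator, norm_one, one_mul, Real.log_exp]
      rw [abs_le] at *
      constructor <;> linarith [h1.1, h1.2]
  · obtain ⟨R, hR1, hR⟩ := exists_norm_x_cube_le W
    set l : ℝ := min (1 / 4) (1 / (C ^ 2 * R)) with hl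
    refine ⟨1 / 2 * (|B| + (|Real.log l| + |Real.log C|)), fun Q hQ => ?_⟩
    cases Q with
    | zero =>
      have : (canonicalMetric W).norm (.zero, Chart.U.generator (0 : W.Point)) = 1 := by
        change ‖Chart.U.generator (0 : W.Point)‖ * Real.exp (-0) = 1
        simp [Chart.generator]
      change |Real.log ((canonicalMetric W).norm (.zero, Chart.U.generator (0 : W.Point)))| ≤ _
      rw [this, Real.log_one, abs_zero]
      positivity
    | some x y h =>
      obtain ⟨hx, hy, h1, h2, h3⟩ := hQ.resolve_left (WeierstrassCurve.Affine.Point.some_ne_zero h)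
      simp only [xCoord, yCoord, norm_div, norm_pow, norm_one] at hx hy h1 h2 h3
      have hxp : 0 < ‖x‖ := norm_pos_iff.2 hx
      have hyp : 0 < ‖y‖ := norm_pos_iff.2 hy
      have hC : 0 < C := lt_of_lt_of_le (by positivity) h1
      have hmp : 0 < max ‖x‖ 1 := by positivity
      set r : ℝ := ‖y‖ ^ 2 / (‖x‖ ^ 2 * max ‖x‖ 1) with hr
      have hrp : 0 < r := by positivity
      have hrC : r ≤ C := by
        refine le_trans ?_ h3
        rw [hr, pow_succ ‖x‖ 2]
        gcongr
        exact le_max_left _ _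
      have hlp : 0 < l := by positivity
      have hlr : l ≤ r := by
        rcases le_total R ‖x‖ with hRx | hRx
        · refine (min_le_left _ _).trans ?_
          have h4 := (hR x y h.1 hRx).1
          rw [hr, max_eq_left (hR1.trans hRx), ← pow_succ, div_le_div_iff₀ (by norm_num)
            (by positivity), one_mul, mul_comm]
          exact h4
        · refine (min_le_right _ _).trans ?_
          have hm : max ‖x‖ 1 ≤ R := max_le hRx hR1
          rw [div_le_iff₀ hyp] at h1
          rw [hr, div_le_div_iff₀ (by positivity) (by positivity), one_mul]
          calc ‖x‖ ^ 2 * max ‖x‖ 1 ≤ (C * ‖y‖) ^ 2 * R := by gcongr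
            _ = ‖y‖ ^ 2 * (C ^ 2 * R) := by ring
      have hlog1 := Real.log_le_log hlp hlr
      have hlog2 := Real.log_le_log hrp hrC
      have hlogr : Real.log r =
          2 * Real.log ‖y‖ - (2 * Real.log ‖x‖ + Real.log (max ‖x‖ 1)) := by
        rw [hr, Real.log_div (by positivity) (by positivity), Real.log_mul (by positivity)
          hmp.ne', Real.log_pow, Real.log_pow]
        push_cast
        ring
      have hval : Real.log ((canonicalMetric W).norm
          (.some x y h, Chart.U.generator (.some x y h))) =
          Real.log ‖y‖ - Real.log ‖x‖ - pointHeight W (.some x y h) := by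
        have hg : ‖Chart.U.generator (WeierstrassCurve.Affine.Point.some x y h)‖ = ‖y‖ / ‖x‖ := by
          rw [Chart.generator, if_neg (WeierstrassCurve.Affine.Point.some_ne_zero h)]
          simp [tCoord, xCoord, yCoord]
        simp only [canonicalMetric]
        rw [hg, Real.log_mul (by positivity) (Real.exp_pos _).ne', Real.log_exp,
          Real.log_div hyp.ne' hxp.ne']
        ring
      rw [hval]
      have h5 := hB x y h
      rw [abs_le] at *
      constructor <;> linarith [h5.1, h5.2, le_abs_self B, neg_abs_le (Real.log l),
        le_abs_self (Real.log C), abs_nonneg (Real.log l), abs_nonneg (Real.log C)]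

variable {W}

open Classical in
theorem norm_dupIso_mul_exp (Q : W.Point) :
    ‖dupIso W Q‖ * Real.exp (-pointHeight W ((2 : ℕ) • Q)) =
      Real.exp (-pointHeight W Q) ^ 4 := by
  rw [← Real.exp_nat_mul]
  cases Q with
  | zero =>
    change ‖(1 : K)‖ * Real.exp (-pointHeight W ((2 : ℕ) • (0 : W.Point))) = Real.exp (_ * -0)
    rw [nsmul_zero]
    change ‖(1 : K)‖ * Real.exp (-0) = Real.exp (_ * -0)
    simp
  | some x y h =>
    by_cases hψ : psi W x y = 0
    · have hG := homHeight_of_psi_eq_zero h hψ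
      have hN := norm_pos_iff.2 (tangentNum_ne_zero h hψ)
      rw [two_nsmul_of_psi_eq_zero h hψ, dupIso, if_pos hψ, norm_neg, norm_inv]
      change _ * Real.exp (-0) = Real.exp ((4 : ℕ) * -(1 / 2 * homHeight W (x, 1)))
      have e : ((4 : ℕ) : ℝ) * -(1 / 2 * homHeight W (x, 1)) = -Real.log ‖tangentNum W x y‖ := by
        rw [← hG]; push_cast; ring
      rw [e, Real.exp_neg (Real.log _), Real.exp_log hN]
      simp
    · obtain ⟨h', e⟩ := two_nsmul_of_psi_ne_zero h hψ
      have hψp := norm_pos_iff.2 hψ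
      rw [e, dupIso, if_neg hψ, norm_neg, norm_inv, pointHeight, pointHeight,
        homHeight_of_psi_ne_zero h.1 hψ]
      have e2 : -(1 / 2 * (4 * homHeight W (x, 1) - 2 * Real.log ‖psi W x y‖)) =
          ((4 : ℕ) : ℝ) * -(1 / 2 * homHeight W (x, 1)) + Real.log ‖psi W x y‖ := by
        push_cast; ring
      rw [e2, Real.exp_add, Real.exp_log hψp]
      field_simp

end CanonicalMetricExistence

section CanonicalMetricUniqueness

variable {K : Type*} [NormedField K] {W : WeierstrassCurve.Affine K}

theorem Metric.norm_eq (M : Metric W) (Q : W.Point) (z : K) :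
    M.norm (Q, z) = ‖z‖ * M.norm (Q, 1) := by
  rw [← M.smul, mul_one]

/-- Two bounded parts, one of each chart, cover the curve. -/
theorem exists_mem_boundedPart (W : WeierstrassCurve.Affine K) :
    ∃ C : ℝ, ∀ Q : W.Point, ∃ i : Chart, Q ∈ i.boundedPart C := by
  obtain ⟨R, hR1, hR⟩ := exists_norm_x_cube_le W
  obtain ⟨R', hR'⟩ := exists_norm_y_le W R
  refine ⟨max 4 (max R R'), fun Q => ?_⟩
  cases Q with
  | zero => exact ⟨.U, Or.inl rfl⟩
  | some x y h =>
    rcases le_total ‖x‖ R with hx | hx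
    · exact ⟨.Y, WeierstrassCurve.Affine.Point.some_ne_zero h,
        hx.trans ((le_max_left _ _).trans (le_max_right _ _)),
        (hR' x y h.1 hx).trans ((le_max_right _ _).trans (le_max_right _ _))⟩
    · obtain ⟨h1, h2⟩ := hR x y h.1 hx
      have hx1 : 1 ≤ ‖x‖ := hR1.trans hx
      have hxp : 0 < ‖x‖ := by linarith
      have hyp : 0 < ‖y‖ := by
        by_contra h0
        have h00 : ‖y‖ = 0 := le_antisymm (not_lt.1 h0) (norm_nonneg y)
        rw [h00] at h1
        have : 0 < ‖x‖ ^ 3 := by positivity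
        linarith
      have hxy : ‖x‖ ≤ 4 * ‖y‖ := by
        refine le_of_sq_le_sq ?_ (by positivity)
        have : ‖x‖ ^ 2 ≤ ‖x‖ ^ 3 := by nlinarith [sq_nonneg ‖x‖]
        nlinarith [sq_nonneg ‖y‖]
      refine ⟨.U, Or.inr ⟨norm_pos_iff.1 hxp, norm_pos_iff.1 hyp, ?_, ?_, ?_⟩⟩
      all_goals
        refine le_trans ?_ (le_max_left _ _)
        simp only [xCoord, yCoord, norm_div, norm_pow, norm_one]
        rw [div_le_iff₀ (by positivity)]
        linarith

theorem Chart.generator_ne_zero {i : Chart} {C : ℝ} {Q : W.Point} (hQ : Q ∈ i.boundedPart C) :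
    i.generator Q ≠ 0 := by
  cases i with
  | Y => exact one_ne_zero
  | U =>
    rw [Chart.generator]
    split_ifs with h
    · exact one_ne_zero
    · obtain ⟨hx, hy, -⟩ := hQ.resolve_left h
      exact inv_ne_zero (div_ne_zero (neg_ne_zero.2 hx) hy)

/-- The logarithm of the ratio of two canonical metrics is bounded on all of `E`, as two bounded
parts of the charts cover `E`, and it is quadrupled by duplication. -/
theorem Metric.IsCanonical.unique {M M' : Metric W} (h : M.IsCanonical) (h' : M'.IsCanonical) :
    M = M' := by
  classical
  have hpos : ∀ Q, 0 < M.norm (Q, 1) := fun Q => M.pos Q 1 one_ne_zero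
  have hpos' : ∀ Q, 0 < M'.norm (Q, 1) := fun Q => M'.pos Q 1 one_ne_zero
  obtain ⟨C, hC⟩ := exists_mem_boundedPart W
  choose B hB using fun i => h.locallyBounded i C
  choose B' hB' using fun i => h'.locallyBounded i C
  have key : ∀ Q : W.Point, Real.log (M.norm (Q, 1)) - Real.log (M'.norm (Q, 1)) = 0 := fun Q =>
    eq_zero_of_bounded_of_quadrupled (s := Set.univ) (T := fun Q : W.Point => (2 : ℕ) • Q)
      (D := fun Q => Real.log (M.norm (Q, 1)) - Real.log (M'.norm (Q, 1)))
      (B := max (B .Y + B' .Y) (B .U + B' .U)) (fun _ _ => Set.mem_univ _)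
      (fun Q _ => by
        obtain ⟨i, hi⟩ := hC Q
        have hg := Chart.generator_ne_zero hi
        have hgn := norm_ne_zero_iff.2 hg
        have h1 := hB i Q hi
        have h2 := hB' i Q hi
        rw [M.norm_eq, Real.log_mul hgn (hpos Q).ne'] at h1
        rw [M'.norm_eq, Real.log_mul hgn (hpos' Q).ne'] at h2
        have h3 : B i + B' i ≤ max (B .Y + B' .Y) (B .U + B' .U) := by
          cases i
          · exact le_max_left _ _
          · exact le_max_right _ _
        rw [abs_le] at *
        constructor <;> linarith [h1.1, h1.2, h2.1, h2.2])
      (fun Q _ => by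
        have hb := norm_ne_zero_iff.2 (dupIso_ne_zero Q)
        have h1 := congrArg Real.log (h.isometry _ isRigidifiedIso_dupIso Q 1)
        have h2 := congrArg Real.log (h'.isometry _ isRigidifiedIso_dupIso Q 1)
        rw [one_pow, mul_one, M.norm_eq, Real.log_mul hb (hpos _).ne', Real.log_pow] at h1
        rw [one_pow, mul_one, M'.norm_eq, Real.log_mul hb (hpos' _).ne', Real.log_pow] at h2
        push_cast at h1 h2
        linarith)
      (Set.mem_univ Q)
  ext ⟨Q, z⟩
  rw [M.norm_eq, M'.norm_eq,
    Real.log_injOn_pos (hpos Q) (hpos' Q) (sub_eq_zero.1 (key Q))]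

end CanonicalMetricUniqueness

theorem isCanonical_canonicalMetric {K : Type*} [NontriviallyNormedField K] [IsAlgClosed K]
    (W : WeierstrassCurve.Affine K) [W.IsElliptic] : (canonicalMetric W).IsCanonical where
  locallyBounded := isLocallyBounded_canonicalMetric W
  isometry := by
    classical
    intro b hb Q z
    rw [hb.eq_dupIso]
    simp only [canonicalMetric]
    rw [norm_mul, norm_pow, mul_pow, ← norm_dupIso_mul_exp Q]
    ring

/-! ### Comparison over `ℚ_ℓ` -/

instance isElliptic_baseChange_toAffine {R F : Type*} [CommRing R] [Field F] [Algebra R F]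
    (W : WeierstrassCurve R) [W.IsElliptic] :
    WeierstrassCurve.IsElliptic (W.baseChange F).toAffine :=
  inferInstanceAs (W.map (algebraMap R F)).IsElliptic

theorem halfHeight_eq_neg_log_norm (W : WeierstrassCurve ℚ) [W.IsElliptic] (ℓ : ℕ)
    [Fact ℓ.Prime] (Q : AffinePoint (W.baseChange ℚ_[ℓ]).toAffine) :
    halfHeight (W.baseChange ℚ_[ℓ]).toAffine Q =
      -Real.log ((canonicalMetric (W.baseChange (PadicAlgCl ℓ)).toAffine).norm
        (unitSection (affineInclusion W ℓ Q))) := by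
  obtain ⟨Q, hQ⟩ := Q
  cases Q with
  | zero => exact absurd rfl hQ
  | some x y h =>
    have hW : W.baseChange (PadicAlgCl ℓ) =
        (W.baseChange ℚ_[ℓ]).map (algebraMap ℚ_[ℓ] (PadicAlgCl ℓ)) :=
      (W.map_baseChange (IsScalarTower.toAlgHom ℚ ℚ_[ℓ] (PadicAlgCl ℓ))).symm
    have hmap := homHeight_map (W.baseChange ℚ_[ℓ]).toAffine
      (algebraMap ℚ_[ℓ] (PadicAlgCl ℓ)) (PadicAlgCl.norm_extends ℓ)
      (W' := (W.baseChange (PadicAlgCl ℓ)).toAffine) hW (pair_one_ne_zero x)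
    rw [map_one] at hmap
    change 1 / 2 * homHeight (W.baseChange ℚ_[ℓ]).toAffine (x, 1) =
      -Real.log (‖(1 : PadicAlgCl ℓ)‖ * Real.exp (-(1 / 2 *
        homHeight (W.baseChange (PadicAlgCl ℓ)).toAffine
          (algebraMap ℚ_[ℓ] (PadicAlgCl ℓ) x, 1))))
    rw [hmap, norm_one, one_mul, Real.log_exp, neg_neg]

end

end EllipticMetric

theorem mainTheorem12 (W : WeierstrassCurve ℚ) [W.IsElliptic] (ℓ : ℕ) [Fact ℓ.Prime] :
    (∃! lam : EllipticMetric.AffinePoint (W.baseChange ℚ_[ℓ]).toAffine → ℝ,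
      EllipticMetric.IsLocalHeight lam) ∧
    (∃! M : EllipticMetric.Metric (W.baseChange (PadicAlgCl ℓ)).toAffine, M.IsCanonical) ∧
    ∀ (lam : EllipticMetric.AffinePoint (W.baseChange ℚ_[ℓ]).toAffine → ℝ)
      (M : EllipticMetric.Metric (W.baseChange (PadicAlgCl ℓ)).toAffine),
      EllipticMetric.IsLocalHeight lam → M.IsCanonical →
      ∀ Q : EllipticMetric.AffinePoint (W.baseChange ℚ_[ℓ]).toAffine,
        lam Q = -Real.log
          (M.norm (EllipticMetric.unitSection (EllipticMetric.affineInclusion W ℓ Q))) := by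
  have hlam : EllipticMetric.IsLocalHeight
      (EllipticMetric.halfHeight (W.baseChange ℚ_[ℓ]).toAffine) :=
    EllipticMetric.isLocalHeight_halfHeight
  have hM : (EllipticMetric.canonicalMetric (W.baseChange (PadicAlgCl ℓ)).toAffine).IsCanonical :=
    EllipticMetric.isCanonical_canonicalMetric _
  refine ⟨⟨_, hlam, fun lam h => h.unique hlam⟩, ⟨_, hM, fun M h => h.unique hM⟩,
    fun lam M h h' Q => ?_⟩
  rw [h.unique hlam, h'.unique hM]
  exact EllipticMetric.halfHeight_eq_neg_log_norm W ℓ Q
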